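/- Let $1<\alpha<2$, $0<\gamma<1$, $\lambda\ge 0$, $\rho>0$, $\eta\in\mathbb R$, $K,b,T>0$, $U\ge 0$ on $(0,b)$, $p=\rho+\mathrm i\eta$, and $\tilde\lambda(x)=\lambda+pU(x)$. For fixed $p$ let $G(x,t)$ be a (complex-valued, pointwise) solution of the time-tempered fractional Feynman–Kac problem $$D_t^{\gamma,\tilde\lambda}\big[G(x,t)-e^{-\tilde\lambda(x)t}G(x,0)\big]-\lambda^\gamma G(x,t)=K\nabla_x^\alpha G(x,t)+f(x,t),\qquad x\in(0,b),\ t\in(0,T],$$ with $G(x,0)=G_0(x)$ for $x\in(0,b)$ and $G(x,t)=0$ for $x\in\mathbb R\setminus(0,b)$, $t\in(0,T]$. Here $$D_t^{\gamma,\tilde\lambda}g(t)=\frac1{\Gamma(1-\gamma)}\Big(\frac{\partial}{\partial t}+\tilde\lambda\Big)\int_0^t(t-z)^{-\gamma}e^{-\tilde\lambda(t-z)}g(z)\,dz,$$ $$\nabla_x^\alpha u(x)=-\frac{\kappa_\alpha}{\Gamma(2-\alpha)}\frac{d^2}{dx^2}\Big(\int_{-\infty}^x(x-\xi)^{1-\alpha}u(\xi)\,d\xi+\int_x^\infty(\xi-x)^{1-\alpha}u(\xi)\,d\xi\Big),\qquad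 \kappa_\alpha=\frac1{2\cos(\alpha\pi/2)}$$ (the two one-sided derivatives are taken separately, and $\partial/\partial t$ is one-sided at $t=T$). Put $\kappa=-K\kappa_\alpha>0$. For integers $M\ge 1$, $N\ge 0$ and $\tau>0$ with $N\tau\le T$ let $h=b/M$, $x_i=ih$, $t_n=n\tau$. Let $g^s_0=1$, $g^s_k=(1-\frac{s+1}k)g^s_{k-1}$; $w_0=\frac\alpha2g_0^\alpha$, $w_k=\frac\alpha2g^\alpha_k+\frac{2-\alpha}2g^\alpha_{k-1}$ for $k\ge1$; $w_{i,i}=2w_1$, $w_{i,j}=w_0+w_2$ if $|i-j|=1$, $w_{i,j}=w_{|i-j|+1}$ if $|i-j|\ge2$; $l_m=(3/2)^\gamma\sum_{k=0}^m3^{-k}g^\gamma_kg^\gamma_{m-k}$; $\sigma_\tau=\big((1-e^{-\lambda\tau})+\tfrac12(1-e^{-\lambda\tau})^2\big)^\gamma$; $l_0^{(2)}=l_0-\sigma_\tau$ and, at the point $x_i$, $l_k^{(2)}=e^{-(\lambda+\rho U(x_i))k\tau}\,l_k$ for $k\ge1$. The numerical solution $G_i^n$ satisfies, for $1\le i\le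 M-1$ and $1\le n\le N$, $$\frac1{\tau^\gamma}\sum_{k=0}^nl_k^{(2)}e^{-\mathrm i\eta U(x_i)k\tau}G_i^{n-k}-\frac{\kappa}{h^\alpha}\sum_{j=0}^Mw_{i,j}G_j^n=\frac1{\tau^\gamma}\sum_{k=0}^nl_k\,e^{-\tilde\lambda(x_i)n\tau}G_i^0+f(x_i,t_n),$$ with $G_i^0=G_0(x_i)$ for $1\le i\le M-1$ and $G_0^n=G_M^n=0$ for $1\le n\le N$. Let $\varepsilon_i^n=G(x_i,t_n)-G_i^n$ be the error and $\|u\|=\big(h\sum_{i=1}^{M-1}|u_i|^2\big)^{1/2}$, and let the local truncation error be $$r_i^n=\frac1{\tau^\gamma}\sum_{k=0}^ne^{-\tilde\lambda(x_i)k\tau}l_k\Big[G(x_i,t_{n-k})-e^{-\tilde\lambda(x_i)(n-k)\tau}G(x_i,0)\Big]-\frac{\sigma_\tau}{\tau^\gamma}G(x_i,t_n)-\frac{\kappa}{h^\alpha}\sum_{j=0}^Mw_{i,j}G(x_j,t_n)-f(x_i,t_n).$$ **(a)** On every such mesh, and for every constant $C_G>0$ with $|r_i^n|\le C_G(\tau^2+h^2)$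 for all $1\le i\le M-1$, $1\le n\le N$, every numerical solution satisfies $$\tau\sum_{n=1}^N\|\varepsilon^n\|\le\frac{C_G\,|\Gamma(1-\alpha)|\,b^{\alpha+1/2}\,T}{2\kappa}\,(\tau^2+h^2).$$ **(b)** Suppose that $G$ is regular in the following sense, where $\widehat{\phantom{v}}$ denotes the Fourier transform $\widehat v(\omega)=\int_{\mathbb R} e^{\mathrm i\omega t}v(t)\,dt$. For every $x\in(0,b)$ the function $t\mapsto G(x,t)-e^{-\tilde\lambda(x)t}G(x,0)$ on $[0,T]$ has an extension $V_x$ to $\mathbb R$ that is continuous, integrable and zero for $t<0$, with $\int_{\mathbb R}(1+|\tilde\lambda(x)-\mathrm i\omega|)^{\gamma+2}|\widehat{V_x}(\omega)|\,d\omega$ bounded uniformly in $x$. For every $t\in(0,T]$ the function $G(\cdot,t)$ is continuous on $\mathbb R$, with $\int_{\mathbb R}(1+|\omega|)^{\alpha+2}|\widehat{G(\cdot,t)}(\omega)|\,d\omega$ bounded uniformly in $t$. Then there is a constant $C_G>0$, independent of $\tau$, $h$ and $N$, such that $|r_i^n|\le C_G(\tau^2+h^2)$ and the estimate in (a) hold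 on all meshes. So the scheme converges with second order in both time and space. -/

import Mathlib

open Real Set Filter Topology MeasureTheory Finset
open scoped FourierTransform

namespace FeynmanKac

noncomputable section

/-- The data of the initial-boundary value problem for the time-tempered fractional Feynman-Kac
equation on `Ω = (0, b)`, `0 < t ≤ T`, for one fixed value `p = ρ + J η` of the dual variable. -/
structure Problem where
  α : ℝ
  γ : ℝ
  lam : ℝ
  ρ : ℝ
  η : ℝ
  K : ℝ
  b : ℝ
  T : ℝ
  /-- the function that defines the functional -/
  U : ℝ → ℝ
  /-- the source term `f (x, p, t)` -/
  f : ℝ → ℝ → ℂ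
  /-- the initial value `G₀ (x, p)` -/
  G₀ : ℝ → ℂ
  one_lt_α : 1 < α
  α_lt_two : α < 2
  γ_pos : 0 < γ
  γ_lt_one : γ < 1
  lam_nonneg : 0 ≤ lam
  ρ_pos : 0 < ρ
  K_pos : 0 < K
  b_pos : 0 < b
  T_pos : 0 < T
  U_nonneg : ∀ x ∈ Set.Ioo 0 b, 0 ≤ U x

/-! ### The fractional operators -/

/-- `∫₀ᵗ (t - z)^(-γ) exp (-μ (t - z)) g z dz`. -/
def substantialIntegral (γ : ℝ) (μ : ℂ) (g : ℝ → ℂ) (t : ℝ) : ℂ :=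
  ∫ z in (0 : ℝ)..t, (((t - z) ^ (-γ) : ℝ) : ℂ) * Complex.exp (-μ * ((t - z : ℝ) : ℂ)) * g z

/-- `D` is the value at `t ∈ (0, T]` of the substantial derivative
`1 / Γ(1-γ) * (∂/∂t + μ) ∫₀ᵗ (t - z)^(-γ) exp (-μ (t - z)) g z dz` of a function `g` on `[0, T]`
(at `t = T` the derivative is the one-sided one); the integrals are required to converge. -/
def HasSubstantialDeriv (γ : ℝ) (μ : ℂ) (T : ℝ) (g : ℝ → ℂ) (t : ℝ) (D : ℂ) : Prop :=
  (∀ s ∈ Set.Ioc 0 T, IntervalIntegrable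
    (fun z : ℝ => (((s - z) ^ (-γ) : ℝ) : ℂ) * Complex.exp (-μ * ((s - z : ℝ) : ℂ)) * g z)
    volume 0 s) ∧
  ∃ d : ℂ, HasDerivWithinAt (substantialIntegral γ μ g) d (Set.Icc 0 T) t ∧
    D = ((1 / Real.Gamma (1 - γ) : ℝ) : ℂ) * (d + μ * substantialIntegral γ μ g t)

/-- `d` is the second derivative of `F` at `x`. -/
def HasSecondDerivAt (F : ℝ → ℂ) (d : ℂ) (x : ℝ) : Prop :=
  ∃ F' : ℝ → ℂ, (∀ᶠ y in 𝓝 x, HasDerivAt F (F' y) y) ∧ HasDerivAt F' d x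

/-- `D` is the left Riemann-Liouville derivative of order `α` of `u` at `x`, with base point
`-∞`. -/
def HasLeftDeriv (α : ℝ) (u : ℝ → ℂ) (x : ℝ) (D : ℂ) : Prop :=
  (∀ y : ℝ, IntegrableOn (fun ξ : ℝ => (((y - ξ) ^ (1 - α) : ℝ) : ℂ) * u ξ) (Set.Iio y)) ∧
  ∃ d : ℂ,
    HasSecondDerivAt (fun y : ℝ => ∫ ξ in Set.Iio y, (((y - ξ) ^ (1 - α) : ℝ) : ℂ) * u ξ) d x ∧
    D = ((1 / Real.Gamma (2 - α) : ℝ) : ℂ) * d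

/-- `D` is the right Riemann-Liouville derivative of order `α` of `u` at `x`, with base point
`+∞`. -/
def HasRightDeriv (α : ℝ) (u : ℝ → ℂ) (x : ℝ) (D : ℂ) : Prop :=
  (∀ y : ℝ, IntegrableOn (fun ξ : ℝ => (((ξ - y) ^ (1 - α) : ℝ) : ℂ) * u ξ) (Set.Ioi y)) ∧
  ∃ d : ℂ,
    HasSecondDerivAt (fun y : ℝ => ∫ ξ in Set.Ioi y, (((ξ - y) ^ (1 - α) : ℝ) : ℂ) * u ξ) d x ∧
    D = ((1 / Real.Gamma (2 - α) : ℝ) : ℂ) * d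

/-- `κ_α = 1 / (2 cos (α π / 2))`. -/
def rieszConst (α : ℝ) : ℝ := 1 / (2 * Real.cos (α * π / 2))

/-- `D` is the Riesz derivative of order `α` of `u` at `x`. -/
def HasRieszDeriv (α : ℝ) (u : ℝ → ℂ) (x : ℝ) (D : ℂ) : Prop :=
  ∃ Dl Dr : ℂ, HasLeftDeriv α u x Dl ∧ HasRightDeriv α u x Dr ∧
    D = -(rieszConst α : ℂ) * (Dl + Dr)

/-! ### The exact solution -/

/-- The complex tempering parameter `λ + p U(x)` with `p = ρ + J η`. -/
def Problem.rate (P : Problem) (x : ℝ) : ℂ :=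
  (P.lam : ℂ) + ((P.ρ : ℂ) + Complex.I * (P.η : ℂ)) * (P.U x : ℂ)

/-- The function `t ↦ G(x, t) - exp (-(λ + p U(x)) t) G(x, 0)`, whose substantial derivative is
the main part of the Caputo tempered fractional substantial derivative. -/
def Problem.shifted (P : Problem) (G : ℝ → ℝ → ℂ) (x t : ℝ) : ℂ :=
  G x t - Complex.exp (-P.rate x * (t : ℂ)) * G x 0

/-- `G` is a (pointwise) solution of the initial-boundary value problem
`ᶜD_t^γ G = K ∇_x^α G + f` on `(0, b) × (0, T]`, `G(x, 0) = G₀(x)` on `(0, b)`, and `G(x, t) = 0`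
for `x` outside `(0, b)` and `t ∈ (0, T]`. -/
structure Problem.IsSolution (P : Problem) (G : ℝ → ℝ → ℂ) : Prop where
  equation : ∀ x ∈ Set.Ioo 0 P.b, ∀ t ∈ Set.Ioc 0 P.T, ∃ Dt Dx : ℂ,
    HasSubstantialDeriv P.γ (P.rate x) P.T (P.shifted G x) t Dt ∧
    HasRieszDeriv P.α (fun y => G y t) x Dx ∧
    Dt - ((P.lam ^ P.γ : ℝ) : ℂ) * G x t = (P.K : ℂ) * Dx + P.f x t
  initial : ∀ x ∈ Set.Ioo 0 P.b, G x 0 = P.G₀ x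
  boundary : ∀ x, x ∉ Set.Ioo 0 P.b → ∀ t ∈ Set.Ioc 0 P.T, G x t = 0

/-- Regularity in time: for every `x`, the function `t ↦ G(x, t) - exp (-(λ + p U(x)) t) G(x, 0)`
on `[0, T]`, extended by zero to negative times and suitably to times after `T`, is continuous and
integrable on `ℝ`, and its Fourier transform, as well as that of its substantial derivative of
order `γ + 2` (whose symbol is `(λ + p U(x) + 2 π J w)^(γ + 2)` in Mathlib's normalization of the
Fourier transform), is integrable, with bounds uniform in `x`. -/
def Problem.TimeRegular (P : Problem) (G : ℝ → ℝ → ℂ) : Prop :=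
  ∃ B : ℝ, ∀ x ∈ Set.Ioo 0 P.b, ∃ V : ℝ → ℂ,
    Continuous V ∧ Integrable V ∧ (∀ t < 0, V t = 0) ∧
    (∀ t ∈ Set.Icc 0 P.T, V t = P.shifted G x t) ∧
    Integrable (fun w : ℝ =>
      (1 + ‖P.rate x + 2 * π * Complex.I * (w : ℂ)‖) ^ (P.γ + 2) * ‖𝓕 V w‖) ∧
    ∫ w : ℝ, (1 + ‖P.rate x + 2 * π * Complex.I * (w : ℂ)‖) ^ (P.γ + 2) * ‖𝓕 V w‖ ≤ B

/-- Regularity in space: for every `t ∈ (0, T]` the function `G(·, t)` is continuous on `ℝ`, and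
its Fourier transform, as well as those of its one-sided fractional derivatives of order `α + 2`
(whose symbols have absolute value `|2 π w|^(α + 2)`), is integrable, with bounds uniform
in `t`. -/
def Problem.SpaceRegular (P : Problem) (G : ℝ → ℝ → ℂ) : Prop :=
  ∃ B : ℝ, ∀ t ∈ Set.Ioc 0 P.T,
    Continuous (fun x => G x t) ∧
    Integrable (fun w : ℝ => (1 + |2 * π * w|) ^ (P.α + 2) * ‖𝓕 (fun x => G x t) w‖) ∧
    ∫ w : ℝ, (1 + |2 * π * w|) ^ (P.α + 2) * ‖𝓕 (fun x => G x t) w‖ ≤ B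

/-! ### The coefficients of the difference scheme -/

/-- `g_k^s = (-1)^k (s choose k)`; these are also the coefficients `l_k^{1,s}`. -/
def grunwald (s : ℝ) : ℕ → ℝ
  | 0 => 1
  | k + 1 => (1 - (s + 1) / ((k + 1 : ℕ) : ℝ)) * grunwald s k

/-- `l_m^{2,γ} = (3/2)^γ ∑_{k=0}^m 3^{-k} l_k^{1,γ} l_{m-k}^{1,γ}`. -/
def lubich (γ : ℝ) (m : ℕ) : ℝ :=
  (3 / 2 : ℝ) ^ γ * ∑ k ∈ Finset.range (m + 1), (1 / 3 : ℝ) ^ k * grunwald γ k * grunwald γ (m - k)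

/-- `(∑_{l=1}^2 (1/l) (1 - e^{-λτ})^l)^γ`. -/
def temperConst (γ lam τ : ℝ) : ℝ :=
  (∑ l ∈ Finset.Icc (1 : ℕ) 2, (1 / (l : ℝ)) * (1 - Real.exp (-lam * τ)) ^ l) ^ γ

/-- `w_0^α = (α/2) g_0^α`, `w_k^α = (α/2) g_k^α + ((2-α)/2) g_{k-1}^α`. -/
def spaceWeight (α : ℝ) : ℕ → ℝ
  | 0 => α / 2 * grunwald α 0
  | k + 1 => α / 2 * grunwald α (k + 1) + (2 - α) / 2 * grunwald α k

/-- The entries `w_{i,j}^α` of the discrete Riesz operator. -/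
def spaceEntry (α : ℝ) (i j : ℕ) : ℝ :=
  if j + 1 < i then spaceWeight α (i - j + 1)
  else if j + 1 = i then spaceWeight α 0 + spaceWeight α 2
  else if j = i then 2 * spaceWeight α 1
  else if j = i + 1 then spaceWeight α 0 + spaceWeight α 2
  else spaceWeight α (j - i + 1)

/-- The coefficient `l_k^{(2)}` at the point `x`, for the time step `τ`. -/
def Problem.timeCoeff (P : Problem) (τ x : ℝ) (k : ℕ) : ℝ :=
  if k = 0 then lubich P.γ 0 - temperConst P.γ P.lam τ
  else Real.exp (-(P.lam + P.ρ * P.U x) * k * τ) * lubich P.γ k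

/-- `κ = -K κ_α`. -/
def Problem.kappa (P : Problem) : ℝ := -P.K * rieszConst P.α

/-- The space step `h = b / M`. -/
def Problem.step (P : Problem) (M : ℕ) : ℝ := P.b / M

/-- The grid point `x_i = i h`. -/
def Problem.node (P : Problem) (M i : ℕ) : ℝ := i * P.step M

/-! ### The scheme, its local truncation error and the discrete norm -/

/-- `g i n` (`0 ≤ i ≤ M`, `0 ≤ n ≤ N`) is the numerical solution computed by the second order
difference scheme with `M` space intervals and time step `τ`, starting from the exact initial
value. -/
structure Problem.IsSchemeSolution (P : Problem) (M N : ℕ) (τ : ℝ) (g : ℕ → ℕ → ℂ) : Prop where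
  scheme : ∀ n ∈ Finset.Icc 1 N, ∀ i ∈ Finset.Ioo 0 M,
    ((1 / τ ^ P.γ : ℝ) : ℂ) * ∑ k ∈ Finset.range (n + 1),
        (P.timeCoeff τ (P.node M i) k : ℂ) *
          Complex.exp (-Complex.I * (P.η * P.U (P.node M i) * k * τ : ℝ)) * g i (n - k)
      - ((P.kappa / P.step M ^ P.α : ℝ) : ℂ) * ∑ j ∈ Finset.range (M + 1),
          (spaceEntry P.α i j : ℂ) * g j n
    = ((1 / τ ^ P.γ : ℝ) : ℂ) * ∑ k ∈ Finset.range (n + 1),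
          (lubich P.γ k : ℂ) * Complex.exp (-P.rate (P.node M i) * (n * τ : ℝ)) * g i 0
      + P.f (P.node M i) (n * τ)
  initial : ∀ i ∈ Finset.Ioo 0 M, g i 0 = P.G₀ (P.node M i)
  boundary : ∀ n ∈ Finset.Icc 1 N, g 0 n = 0 ∧ g M n = 0

/-- The local truncation error `r_i^n`: the residual of the exact solution in the discretized
equation at `(x_i, t_n)`. -/
def Problem.truncationError (P : Problem) (G : ℝ → ℝ → ℂ) (M : ℕ) (τ : ℝ) (i n : ℕ) : ℂ :=
  ((1 / τ ^ P.γ : ℝ) : ℂ) * ∑ k ∈ Finset.range (n + 1),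
      Complex.exp (-P.rate (P.node M i) * (k * τ : ℝ)) * (lubich P.γ k : ℂ) *
        G (P.node M i) ((n - k : ℕ) * τ)
    - ((1 / τ ^ P.γ * temperConst P.γ P.lam τ : ℝ) : ℂ) * G (P.node M i) (n * τ)
    - ((1 / τ ^ P.γ : ℝ) : ℂ) * ∑ k ∈ Finset.range (n + 1),
        Complex.exp (-P.rate (P.node M i) * (k * τ : ℝ)) * (lubich P.γ k : ℂ) *
          (Complex.exp (-P.rate (P.node M i) * ((n - k : ℕ) * τ : ℝ)) * G (P.node M i) 0)
    - (((-P.K * rieszConst P.α) / P.step M ^ P.α : ℝ) : ℂ) * ∑ j ∈ Finset.range (M + 1),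
        (spaceEntry P.α i j : ℂ) * G (P.node M j) (n * τ)
    - P.f (P.node M i) (n * τ)

/-- On the mesh with `M` space intervals, time step `τ` and `N` time levels, the local truncation
error is at most `C (τ² + h²)`. -/
def Problem.TruncationBound (P : Problem) (G : ℝ → ℝ → ℂ) (C : ℝ) (M N : ℕ) (τ : ℝ) : Prop :=
  ∀ n ∈ Finset.Icc 1 N, ∀ i ∈ Finset.Ioo 0 M,
    ‖P.truncationError G M τ i n‖ ≤ C * (τ ^ 2 + P.step M ^ 2)

/-- The discrete `L²` norm `‖u‖ = (h ∑_{i=1}^{M-1} |u_i|²)^{1/2}` of a grid function. -/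
def discreteNorm (h : ℝ) (M : ℕ) (u : ℕ → ℂ) : ℝ :=
  Real.sqrt (h * ∑ i ∈ Finset.Ioo 0 M, ‖u i‖ ^ 2)

/-- The error `ε_i^n = G(x_i, t_n) - G_i^n`. -/
def Problem.error (P : Problem) (G : ℝ → ℝ → ℂ) (M : ℕ) (τ : ℝ) (g : ℕ → ℕ → ℂ) (n i : ℕ) : ℂ :=
  G (P.node M i) (n * τ) - g i n

/-- The error estimate with constant `C` on the given mesh: the numerical solution `g` satisfies
`τ ∑_{n=1}^N ‖εⁿ‖ ≤ C |Γ(1-α)| b^{α+1/2} T / (2κ) * (τ² + h²)`. -/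
def Problem.ErrorBound (P : Problem) (G : ℝ → ℝ → ℂ) (C : ℝ) (M N : ℕ) (τ : ℝ)
    (g : ℕ → ℕ → ℂ) : Prop :=
  τ * ∑ n ∈ Finset.Icc 1 N, discreteNorm (P.step M) M (P.error G M τ g n)
    ≤ C * |Real.Gamma (1 - P.α)| * P.b ^ (P.α + 1 / 2) * P.T / (2 * P.kappa)
      * (τ ^ 2 + P.step M ^ 2)

end

end FeynmanKac

namespace FeynmanKac

/-! ### Generating functions of the weights -/

/-! The estimate is an energy argument, and the order of convergence comes from comparing Fourier
symbols.

Stability. The error satisfies the scheme with right-hand side `truncationError` and zero initial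
and boundary values (`error_equation`). Multiply by the conjugate error, sum over interior nodes and
time levels, and take real parts. At a fixed node the time part is a lower triangular Toeplitz form.
Its symbol is `bdf (q z) ^ γ - temperConst γ lam τ` with `q = exp (-rate τ)`, and it has nonnegative
real part for two reasons: on a disc of radius `r ≤ 1` the real part of `bdf` is smallest at `r`,
and `Re (z ^ γ) ≥ (Re z) ^ γ` on the right half-plane. Averaging over the circle makes the form
nonnegative (`toeplitz_form_nonneg`, `lubich_form_ge`). The space matrix is symmetric with
nonnegative off-diagonal entries, so its form is controlled by its row sums. These are partial sums
of binomial coefficients, hence quotients of Gamma functions, and log-convexity of Gamma bounds them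
by a negative multiple of `M ^ (-α)` (`spaceEntry_form_le`). After scaling by `h ^ (-α)` the
coercivity constant no longer depends on the mesh, and two applications of Cauchy-Schwarz give the
bound (`errorBound_of_truncationBound`).

Consistency. By Fourier inversion the solution is a superposition of plane waves. On these the
fractional derivatives act as multiplication by powers of `symbol`, and the quadratures as
multiplication by their generating functions at `exp (-symbol τ)`. The identities are first proved
with positive damping, where every integral and series converges absolutely, and the damping then
tends to zero. A Taylor expansion at the origin together with boundedness away from it shows that
the symbols differ by at most a constant times `|z| ^ (β + 2)`. The assumed weighted integrability
turns this into an error of second order (`norm_quadrature_sub_le`, `exists_truncationBound`). -/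

theorem grunwald_eq_choose (s : ℝ) (k : ℕ) : grunwald s k = (-1) ^ k * Ring.choose s k := by
  induction k with
  | zero => simp [grunwald]
  | succ k ih =>
    have h : ((k : ℝ) + 1) * Ring.choose s (k + 1) = (s - k) * Ring.choose s k := by
      have h1 := Ring.descPochhammer_eq_factorial_smul_choose s (k + 1)
      have h2 := Ring.descPochhammer_eq_factorial_smul_choose s k
      rw [descPochhammer_succ_right] at h1
      simp only [Polynomial.smeval_mul, Polynomial.smeval_sub, Polynomial.smeval_X, pow_one, Polynomial.smeval_natCast, pow_zero, nsmul_eq_mul, mul_one, Nat.factorial_succ] at h1 h2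
      rw [h2] at h1
      have hk : ((k.factorial : ℕ) : ℝ) ≠ 0 := by positivity
      push_cast at h1
      apply mul_left_cancel₀ hk
      linarith
    have hk : ((k : ℝ) + 1) ≠ 0 := by positivity
    have h' : Ring.choose s (k + 1) = (s - k) * Ring.choose s k / (k + 1) := by
      field_simp; linarith
    simp only [grunwald, ih, h', Nat.cast_add, Nat.cast_one, pow_succ]
    field_simp
    ring

theorem hasSum_grunwald (s : ℝ) {z : ℂ} (hz : ‖z‖ < 1) :
    HasSum (fun k => (grunwald s k : ℂ) * z ^ k) ((1 - z) ^ (s : ℂ)) := by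
  have h := (Complex.one_add_cpow_hasFPowerSeriesOnBall_zero (a := (s : ℂ))).hasSum
    (y := -z) (by simpa [enorm_eq_nnnorm, ← NNReal.coe_lt_one] using hz)
  simp only [binomialSeries_apply, List.ofFn_const, List.prod_replicate, smul_eq_mul,
    ← sub_eq_add_neg] at h
  rw [zero_sub, ← sub_eq_add_neg] at h
  have e : ∀ k, (grunwald s k : ℂ) * z ^ k = Ring.choose (s : ℂ) k * (-z) ^ k := by
    intro k
    rw [grunwald_eq_choose, neg_pow z]
    push_cast [Complex.ofReal_choose]
    ring
  simpa only [e] using h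

theorem summable_grunwald (s : ℝ) {r : ℝ} (h0 : 0 ≤ r) (h1 : r < 1) :
    Summable (fun k => |grunwald s k| * r ^ k) := by
  have h := (hasSum_grunwald s (z := r) (by simpa [abs_of_nonneg h0] using h1)).summable.norm
  simpa [abs_of_nonneg h0] using h


theorem summable_norm_grunwald_mul_pow (s : ℝ) {z : ℂ} (hz : ‖z‖ < 1) :
    Summable (fun k => ‖(grunwald s k : ℂ) * z ^ k‖) := by
  simpa using summable_grunwald s (norm_nonneg z) hz

/-- The generating polynomial `(1 - z) + (1 - z)² / 2` of the second order backward difference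
formula. -/
noncomputable def bdf (z : ℂ) : ℂ := (1 - z) + (1 - z) ^ 2 / 2

theorem bdf_eq_mul (z : ℂ) : bdf z = ((3 / 2 : ℝ) : ℂ) * ((1 - z) * (1 - 1 / 3 * z)) := by
  simp only [bdf]; push_cast; ring

/-- Both principal arguments lie strictly between `-π/2` and `π/2`, so their sum does not leave the
principal branch of the logarithm. -/
theorem mul_cpow_of_re_pos {a b : ℂ} (ha : 0 < a.re) (hb : 0 < b.re) (s : ℂ) :
    (a * b) ^ s = a ^ s * b ^ s := by
  have h1 := Complex.abs_arg_lt_pi_div_two_iff.mpr (Or.inl ha)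
  have h2 := Complex.abs_arg_lt_pi_div_two_iff.mpr (Or.inl hb)
  rw [abs_lt] at h1 h2
  have ha0 : a ≠ 0 := by rintro rfl; simp at ha
  have hb0 : b ≠ 0 := by rintro rfl; simp at hb
  rw [Complex.cpow_def_of_ne_zero ha0, Complex.cpow_def_of_ne_zero hb0,
    Complex.cpow_def_of_ne_zero (mul_ne_zero ha0 hb0), ← Complex.exp_add,
    Complex.log_mul ha0 hb0 ⟨by linarith, by linarith⟩, add_mul]

theorem cpow_mul_of_pos {c : ℝ} (hc : 0 < c) (a s : ℂ) :
    ((c : ℂ) * a) ^ s = (c : ℂ) ^ s * a ^ s := by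
  by_cases ha : a = 0
  · subst ha
    by_cases hs : s = 0
    · simp [hs]
    · simp [Complex.zero_cpow hs]
  have hc0 : (c : ℂ) ≠ 0 := by exact_mod_cast hc.ne'
  rw [Complex.cpow_def_of_ne_zero ha, Complex.cpow_def_of_ne_zero hc0,
    Complex.cpow_def_of_ne_zero (mul_ne_zero hc0 ha), ← Complex.exp_add,
    Complex.log_ofReal_mul hc ha, Complex.ofReal_log hc.le, add_mul]

/-- The weights are a Cauchy product: `bdf` factors as `(3/2)(1 - z)(1 - z/3)`, both nonconstant
factors have positive real part in the unit disc, and so the power splits into two binomial series.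
-/
theorem hasSum_lubich (γ : ℝ) {z : ℂ} (hz : ‖z‖ < 1) :
    HasSum (fun k => (lubich γ k : ℂ) * z ^ k) (bdf z ^ (γ : ℂ)) ∧
      Summable (fun k => ‖(lubich γ k : ℂ) * z ^ k‖) := by
  have hz3 : ‖1 / 3 * z‖ < 1 := by
    rw [norm_mul]; norm_num; linarith [norm_nonneg z]
  have hre : ∀ w : ℂ, ‖w‖ < 1 → 0 < (1 - w).re := fun w hw => by
    have := (Complex.re_le_norm w).trans_lt hw
    simpa using this
  have e : ∀ k, (lubich γ k : ℂ) * z ^ k = ((3 / 2 : ℝ) : ℂ) ^ (γ : ℂ) *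
      ∑ j ∈ Finset.range (k + 1), ((grunwald γ j : ℂ) * (1 / 3 * z) ^ j) *
        ((grunwald γ (k - j) : ℂ) * z ^ (k - j)) := by
    intro k
    rw [lubich, ← Complex.ofReal_cpow (by norm_num)]
    push_cast
    rw [mul_assoc, Finset.sum_mul]
    congr 1
    refine Finset.sum_congr rfl fun j hj => ?_
    have : k = j + (k - j) := by have := Finset.mem_range.mp hj; omega
    conv_lhs => rw [this, pow_add, ← this]
    rw [mul_pow]; ring
  have h1 := summable_norm_grunwald_mul_pow γ hz3
  have h2 := summable_norm_grunwald_mul_pow γ hz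
  constructor
  · have := (hasSum_sum_range_mul_of_summable_norm h1 h2).mul_left (((3 / 2 : ℝ) : ℂ) ^ (γ : ℂ))
    rw [(hasSum_grunwald γ hz3).tsum_eq, (hasSum_grunwald γ hz).tsum_eq] at this
    rw [bdf_eq_mul, cpow_mul_of_pos (by norm_num), mul_cpow_of_re_pos (hre _ hz) (hre _ hz3),
      mul_comm ((1 - z) ^ _)]
    simpa only [e] using this
  · simp_rw [e, norm_mul (((3 / 2 : ℝ) : ℂ) ^ (γ : ℂ))]
    exact (summable_norm_sum_mul_range_of_summable_norm h1 h2).mul_left _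

theorem hasSum_spaceWeight (α : ℝ) {z : ℂ} (hz : ‖z‖ < 1) :
    HasSum (fun k => (spaceWeight α k : ℂ) * z ^ k)
      ((((α / 2 : ℝ) : ℂ) + ((1 - α / 2 : ℝ) : ℂ) * z) * (1 - z) ^ (α : ℂ)) ∧
      Summable (fun k => ‖(spaceWeight α k : ℂ) * z ^ k‖) := by
  have h := hasSum_grunwald α hz
  have hs := summable_norm_grunwald_mul_pow α hz
  have e : ∀ k, (spaceWeight α (k + 1) : ℂ) * z ^ (k + 1) =
      ((α / 2 : ℝ) : ℂ) * ((grunwald α (k + 1) : ℂ) * z ^ (k + 1)) +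
        ((1 - α / 2 : ℝ) : ℂ) * z * ((grunwald α k : ℂ) * z ^ k) := by
    intro k; simp only [spaceWeight]; push_cast; ring
  constructor
  · rw [← hasSum_nat_add_iff' 1]
    have h1 := (hasSum_nat_add_iff' 1).mpr h
    have h2 := (h1.mul_left ((α / 2 : ℝ) : ℂ)).add (h.mul_left (((1 - α / 2 : ℝ) : ℂ) * z))
    simp only [← e] at h2
    rw [show (((α / 2 : ℝ) : ℂ) + ((1 - α / 2 : ℝ) : ℂ) * z) * (1 - z) ^ (α : ℂ) -
        ∑ i ∈ Finset.range 1, (spaceWeight α i : ℂ) * z ^ i = _ from ?_]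
    · exact h2
    · simp [spaceWeight, grunwald]; ring
  · rw [← summable_nat_add_iff 1]
    simp_rw [e]
    refine Summable.of_nonneg_of_le (fun _ => norm_nonneg _) (fun k => norm_add_le _ _) ?_
    have h1 := ((summable_nat_add_iff 1).mpr hs).mul_left ‖((α / 2 : ℝ) : ℂ)‖
    have h2 := hs.mul_left ‖((1 - α / 2 : ℝ) : ℂ) * z‖
    simp only [← norm_mul] at h1 h2
    exact h1.add h2

/-! ### Positivity of the time discretization -/

/-- In polar form the claim reduces to `cos θ ^ s ≤ cos (s θ)`. Concavity of the cosine gives `cos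
(s θ) ≥ s cos θ + (1 - s)`, and the weighted arithmetic-geometric mean inequality bounds the right
side below by `cos θ ^ s`. -/
theorem re_cpow_ge {z : ℂ} (hz : 0 < z.re) {s : ℝ} (h0 : 0 < s) (h1 : s < 1) :
    z.re ^ s ≤ (z ^ (s : ℂ)).re := by
  have hz0 : z ≠ 0 := by rintro rfl; simp at hz
  have hn : 0 < ‖z‖ := norm_pos_iff.mpr hz0
  have harg := Complex.abs_arg_lt_pi_div_two_iff.mpr (Or.inl hz)
  rw [abs_lt] at harg
  have hre : z.re = ‖z‖ * Real.cos z.arg := by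
    rw [Complex.cos_arg hz0]; field_simp
  have hpow : (z ^ (s : ℂ)).re = ‖z‖ ^ s * Real.cos (s * z.arg) := by
    rw [Complex.cpow_ofReal_re, mul_comm s]
  have hcos : 0 < Real.cos z.arg := Real.cos_pos_of_mem_Ioo harg
  rw [hpow, hre, Real.mul_rpow hn.le hcos.le]
  refine mul_le_mul_of_nonneg_left ?_ (by positivity)
  have hc := strictConcaveOn_cos_Icc.concaveOn.2 (x := z.arg) (y := 0)
    ⟨harg.1.le, harg.2.le⟩ ⟨by linarith [Real.pi_pos], by linarith [Real.pi_pos]⟩ h0.le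
    (sub_nonneg.mpr h1.le) (by ring)
  simp only [smul_eq_mul, Real.cos_zero, mul_one, mul_zero, add_zero] at hc
  refine le_trans ?_ hc
  have := Real.geom_mean_le_arith_mean2_weighted h0.le (sub_nonneg.mpr h1.le) hcos.le
    zero_le_one (by ring)
  simpa using this

/-- With `x = Re z`, the real part is `3/2 - 2x + x² - ‖z‖²/2`. For fixed modulus it decreases in `x
≤ 1`, so it is smallest at `x = ‖z‖`. The value there decreases as the modulus grows to `r`. -/
theorem re_bdf_ge {z : ℂ} {r : ℝ} (hz : ‖z‖ ≤ r) (hr : r ≤ 1) :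
    (1 - r) + (1 - r) ^ 2 / 2 ≤ (bdf z).re := by
  have h0 := norm_nonneg z
  have hre := abs_le.mp (Complex.abs_re_le_norm z)
  have hsq : ‖z‖ ^ 2 = z.re ^ 2 + z.im ^ 2 := by
    rw [Complex.sq_norm, Complex.normSq_apply]; ring
  have hb : (bdf z).re = 3 / 2 - 2 * z.re + (z.re ^ 2 - z.im ^ 2) / 2 := by
    simp [bdf, pow_two]; ring
  rw [hb]
  nlinarith [mul_nonneg (sub_nonneg.mpr hre.2) (sub_nonneg.mpr (hz.trans hr)),
    mul_nonneg (sub_nonneg.mpr hz) (sub_nonneg.mpr (hz.trans hr)), sq_nonneg (‖z‖ - z.re),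
    mul_nonneg (sub_nonneg.mpr hz) (sub_nonneg.mpr hr), mul_nonneg (sub_nonneg.mpr hre.2) h0]

theorem temperConst_eq (γ lam τ : ℝ) : temperConst γ lam τ =
    ((1 - Real.exp (-lam * τ)) + (1 - Real.exp (-lam * τ)) ^ 2 / 2) ^ γ := by
  have : Finset.Icc 1 2 = {1, 2} := rfl
  rw [temperConst, this, Finset.sum_pair (by norm_num)]
  congr 1; norm_num; ring

/-- The tempering constant is the symbol `bdf ^ γ` evaluated at the real point `exp (-lam τ)`, which
is where the lower bounds on the real part are attained. -/
theorem temperConst_le_re {γ lam τ : ℝ} (h0 : 0 < γ) (h1 : γ < 1) {z : ℂ}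
    (hlam : 0 ≤ lam * τ) (hz : ‖z‖ ≤ Real.exp (-lam * τ)) (hz1 : ‖z‖ < 1) :
    temperConst γ lam τ ≤ (bdf z ^ (γ : ℂ)).re := by
  have he : Real.exp (-lam * τ) ≤ 1 := Real.exp_le_one_iff.mpr (by linarith)
  have hpos : 0 < (bdf z).re := by
    have := re_bdf_ge (le_refl ‖z‖) hz1.le
    nlinarith [sq_nonneg (1 - ‖z‖)]
  rw [temperConst_eq]
  refine le_trans ?_ (re_cpow_ge hpos h0 h1)
  exact Real.rpow_le_rpow (by nlinarith) (re_bdf_ge hz he) h0.le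

/-- The mean of a Fourier monomial over a period. -/
theorem integral_cexp_int_mul (m : ℤ) :
    ∫ θ in (0 : ℝ)..2 * π, Complex.exp (Complex.I * m * θ) = if m = 0 then 2 * (π : ℂ) else 0 := by
  split_ifs with h
  · simp [h]
  · rw [integral_exp_mul_complex (by simp [h])]
    rw [show Complex.I * m * ((2 * π : ℝ) : ℂ) = m * (2 * π * Complex.I) by push_cast; ring,
      Complex.exp_int_mul_two_pi_mul_I m]
    simp

/-- A power series with nonnegative real part on the unit circle has a nonnegative Toeplitz
form. -/
theorem toeplitz_form_nonneg {a : ℕ → ℂ} {F : ℂ → ℂ} (hs : Summable fun k => ‖a k‖)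
    (hF : ∀ z : ℂ, ‖z‖ = 1 → HasSum (fun k => a k * z ^ k) (F z))
    (hσ : ∀ z : ℂ, ‖z‖ = 1 → 0 ≤ (F z).re) (N : ℕ) (v : ℕ → ℂ) :
    0 ≤ (∑ n ∈ Finset.range N, ∑ k ∈ Finset.range (n + 1),
        a k * v (n - k) * (starRingEnd ℂ) (v n)).re := by
  set e : ℤ → ℝ → ℂ := fun m θ => Complex.exp (Complex.I * m * θ) with he
  have he_cont : ∀ m, Continuous (e m) := fun m => by fun_prop
  have he_norm : ∀ m θ, ‖e m θ‖ = 1 := fun m θ => by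
    rw [he]; simp only
    rw [show Complex.I * m * θ = ((m * θ : ℝ) : ℂ) * Complex.I by push_cast; ring,
      Complex.norm_exp_ofReal_mul_I]
  have he_add : ∀ m n θ, e m θ * e n θ = e (m + n) θ := fun m n θ => by
    simp only [he]; rw [← Complex.exp_add]; push_cast; ring_nf
  have he_conj : ∀ m θ, (starRingEnd ℂ) (e m θ) = e (-m) θ := fun m θ => by
    simp only [he]; rw [← Complex.exp_conj]; simp
  have he_pow : ∀ (k : ℕ) θ, (e 1 θ) ^ k = e k θ := fun k θ => by
    simp only [he]; rw [← Complex.exp_nat_mul]; push_cast; ring_nf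
  -- By orthogonality of the exponentials, the Toeplitz form is the mean over the circle of `F |V|²`
  -- for this trigonometric polynomial `V`; only pairs with `m + k = n` survive.
  set V : ℝ → ℂ := fun θ => ∑ n ∈ Finset.range N, v n * e n θ with hV
  have hVc : Continuous V := by
    apply continuous_finsetSum; intro i _; exact continuous_const.mul (he_cont _)
  have hVV : ∀ θ, ((‖V θ‖ ^ 2 : ℝ) : ℂ) =
      ∑ n ∈ Finset.range N, ∑ m ∈ Finset.range N,
        v m * (starRingEnd ℂ) (v n) * e ((m : ℤ) - n) θ := by
    intro θ
    rw [← Complex.normSq_eq_norm_sq, Complex.normSq_eq_conj_mul_self, hV]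
    simp only [map_sum, map_mul, he_conj, Finset.sum_mul_sum]
    refine Finset.sum_congr rfl fun n _ => Finset.sum_congr rfl fun m _ => ?_
    rw [sub_eq_neg_add, ← he_add]; ring
  -- the integrals of the terms of the series
  have hterm : ∀ k : ℕ, ∫ θ in (0 : ℝ)..2 * π, a k * e k θ * ((‖V θ‖ ^ 2 : ℝ) : ℂ) =
      2 * π * ∑ n ∈ Finset.range N, if k ∈ Finset.range (n + 1) then
        a k * v (n - k) * (starRingEnd ℂ) (v n) else 0 := by
    intro k
    have hc : ∀ m n : ℕ, Continuous fun θ => a k * e k θ *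
        (v m * (starRingEnd ℂ) (v n) * e ((m : ℤ) - n) θ) := fun m n =>
      (continuous_const.mul (he_cont _)).mul (continuous_const.mul (he_cont _))
    simp_rw [hVV, Finset.mul_sum]
    rw [intervalIntegral.integral_finsetSum fun n _ =>
      (continuous_finsetSum _ fun m _ => hc m n).intervalIntegrable _ _]
    refine Finset.sum_congr rfl fun n hn => ?_
    rw [intervalIntegral.integral_finsetSum fun m _ => (hc m n).intervalIntegrable _ _]
    have : ∀ m : ℕ, ∫ θ in (0 : ℝ)..2 * π, a k * e k θ *
        (v m * (starRingEnd ℂ) (v n) * e ((m : ℤ) - n) θ) =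
        if m + k = n then 2 * π * (a k * v m * (starRingEnd ℂ) (v n)) else 0 := by
      intro m
      have : ∀ θ, a k * e k θ * (v m * (starRingEnd ℂ) (v n) * e ((m : ℤ) - n) θ) =
          a k * v m * (starRingEnd ℂ) (v n) * e ((k : ℤ) + (m - n)) θ := by
        intro θ; rw [← he_add]; ring
      simp_rw [this]
      rw [intervalIntegral.integral_const_mul, he, integral_cexp_int_mul]
      have : ((k : ℤ) + (m - n) = 0) ↔ m + k = n := by omega
      simp only [this]
      split_ifs <;> ring
    simp_rw [this]
    by_cases hk : k ≤ n
    · rw [if_pos (Finset.mem_range.mpr (by omega)), Finset.sum_eq_single (n - k)]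
      · rw [if_pos (by omega)]
      · intro b _ hb; rw [if_neg (by omega)]
      · intro h; exact absurd (Finset.mem_range.mpr (by have := Finset.mem_range.mp hn; omega)) h
    · rw [if_neg (by simpa using hk), mul_zero]
      exact Finset.sum_eq_zero fun m _ => by rw [if_neg (by omega)]
  have hser : ∀ θ, HasSum (fun k : ℕ => a k * e k θ * ((‖V θ‖ ^ 2 : ℝ) : ℂ))
      (F (e 1 θ) * ((‖V θ‖ ^ 2 : ℝ) : ℂ)) := fun θ => by
    have := (hF _ (he_norm 1 θ)).mul_right ((‖V θ‖ ^ 2 : ℝ) : ℂ)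
    simpa only [he_pow] using this
  have hnorm : ∀ (k : ℕ) θ, ‖a k * e k θ * ((‖V θ‖ ^ 2 : ℝ) : ℂ)‖ = ‖a k‖ * ‖V θ‖ ^ 2 := by
    intro k θ
    rw [norm_mul, norm_mul, he_norm, mul_one, Complex.norm_real, Real.norm_of_nonneg (sq_nonneg _)]
  have hFc : Continuous fun θ => F (e 1 θ) := by
    have : (fun θ => F (e 1 θ)) = fun θ => ∑' k : ℕ, a k * e k θ := by
      ext θ
      have := (hF _ (he_norm 1 θ)).tsum_eq
      simpa only [he_pow] using this.symm
    rw [this]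
    refine continuous_tsum (fun k => continuous_const.mul (he_cont _)) hs fun k θ => ?_
    rw [norm_mul, he_norm, mul_one]
  have hcc : Continuous fun θ => F (e 1 θ) * ((‖V θ‖ ^ 2 : ℝ) : ℂ) :=
    hFc.mul (Complex.continuous_ofReal.comp (hVc.norm.pow 2))
  have hI := intervalIntegral.hasSum_integral_of_dominated_convergence (μ := volume)
    (a := 0) (b := 2 * π) (F := fun (k : ℕ) θ => a k * e k θ * ((‖V θ‖ ^ 2 : ℝ) : ℂ))
    (f := fun θ => F (e 1 θ) * ((‖V θ‖ ^ 2 : ℝ) : ℂ))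
    (fun k θ => ‖a k‖ * ‖V θ‖ ^ 2)
    (fun k => Continuous.aestronglyMeasurable (by have := he_cont k; fun_prop))
    (fun k => .of_forall fun θ _ => (hnorm k θ).le)
    (.of_forall fun θ _ => hs.mul_right _)
    (by simp_rw [tsum_mul_right]
        exact Continuous.intervalIntegrable (by fun_prop) _ _)
    (.of_forall fun θ _ => hser θ)
  simp_rw [hterm] at hI
  have hfin : HasSum (fun k : ℕ => 2 * (π : ℂ) * ∑ n ∈ Finset.range N,
      if k ∈ Finset.range (n + 1) then a k * v (n - k) * (starRingEnd ℂ) (v n) else 0)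
      (2 * π * ∑ n ∈ Finset.range N, ∑ k ∈ Finset.range (n + 1),
        a k * v (n - k) * (starRingEnd ℂ) (v n)) := by
    refine (hasSum_sum fun n _ => ?_).mul_left _
    have := hasSum_sum_of_ne_finset_zero (L := .unconditional ℕ) (s := Finset.range (n + 1))
      (f := fun k : ℕ => if k ∈ Finset.range (n + 1) then
        a k * v (n - k) * (starRingEnd ℂ) (v n) else 0) (fun b hb => if_neg hb)
    rwa [Finset.sum_congr rfl fun k hk => if_pos hk] at this
  have heq := hI.unique hfin
  have hpos : 0 ≤ (∫ θ in (0 : ℝ)..2 * π, F (e 1 θ) * ((‖V θ‖ ^ 2 : ℝ) : ℂ)).re := by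
    have := Complex.reCLM.intervalIntegral_comp_comm (hcc.intervalIntegrable (μ := volume) 0 (2 * π))
    simp only [Complex.reCLM_apply] at this
    rw [← this]
    refine intervalIntegral.integral_nonneg (by positivity) fun θ _ => ?_
    rw [Complex.re_mul_ofReal]
    exact mul_nonneg (hσ _ (he_norm 1 θ)) (sq_nonneg _)
  rw [heq, show (2 * (π : ℂ)) = ((2 * π : ℝ) : ℂ) by push_cast; rfl, Complex.re_ofReal_mul] at hpos
  exact nonneg_of_mul_nonneg_right hpos (by positivity)

/-- The convolution form of the weights of the tempered second order scheme is bounded below, for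
damping factors `q` strictly inside the unit disc. -/
theorem lubich_form_ge_of_norm_lt_one {γ lam τ : ℝ} (h0 : 0 < γ) (h1 : γ < 1)
    (hlam : 0 ≤ lam * τ) {q : ℂ} (hq : ‖q‖ ≤ Real.exp (-lam * τ)) (hq1 : ‖q‖ < 1)
    (N : ℕ) (v : ℕ → ℂ) :
    temperConst γ lam τ * ∑ n ∈ Finset.range N, ‖v n‖ ^ 2 ≤
      (∑ n ∈ Finset.range N, ∑ k ∈ Finset.range (n + 1),
        (lubich γ k : ℂ) * q ^ k * v (n - k) * (starRingEnd ℂ) (v n)).re := by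
  set σ := temperConst γ lam τ
  -- The constant function `σ` as a power series, so that it can be subtracted from the symbol
  -- coefficientwise.
  set d : ℕ → ℂ := fun k => if k = 0 then (σ : ℂ) else 0 with hd
  have hds : ∀ z : ℂ, HasSum (fun k => d k * z ^ k) σ := fun z => by
    have := hasSum_single (f := fun k => d k * z ^ k) 0 (fun k hk => by simp [hd, hk])
    simpa [hd] using this
  have hz1 : ∀ z : ℂ, ‖z‖ = 1 → ‖q * z‖ = ‖q‖ := fun z hz => by rw [norm_mul, hz, mul_one]
  have key := toeplitz_form_nonneg (a := fun k => (lubich γ k : ℂ) * q ^ k - d k)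
    (F := fun z => bdf (q * z) ^ (γ : ℂ) - σ) ?_ ?_ ?_ N v
  · have : ∀ n, ∑ k ∈ Finset.range (n + 1),
        ((lubich γ k : ℂ) * q ^ k - d k) * v (n - k) * (starRingEnd ℂ) (v n) =
        ∑ k ∈ Finset.range (n + 1), (lubich γ k : ℂ) * q ^ k * v (n - k) * (starRingEnd ℂ) (v n)
          - ((σ * ‖v n‖ ^ 2 : ℝ) : ℂ) := by
      intro n
      simp_rw [sub_mul, Finset.sum_sub_distrib]
      congr 1
      rw [Finset.sum_eq_single 0 (fun k _ hk => by simp [hd, hk]) (by simp)]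
      simp only [hd, if_true, Nat.sub_zero]
      rw [mul_assoc, Complex.mul_conj, Complex.normSq_eq_norm_sq]; push_cast; rfl
    simp_rw [this, Finset.sum_sub_distrib, Complex.sub_re] at key
    rw [← Complex.ofReal_sum, Complex.ofReal_re, ← Finset.mul_sum] at key
    linarith
  · have e2 : Summable fun k => ‖d k‖ := by
      have := (hds 1).summable.norm
      simpa using this
    exact Summable.of_nonneg_of_le (fun _ => norm_nonneg _) (fun k => norm_sub_le _ _)
      ((hasSum_lubich γ hq1).2.add e2)
  · intro z hz
    have := (hasSum_lubich γ (z := q * z) (by rw [hz1 z hz]; exact hq1)).1.sub (hds z)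
    simpa only [mul_pow, sub_mul, mul_assoc] using this
  · intro z hz
    have := temperConst_le_re h0 h1 hlam (z := q * z) (by rw [hz1 z hz]; exact hq)
      (by rw [hz1 z hz]; exact hq1)
    simpa using this

/-- The boundary case `‖q‖ = 1`, which occurs for `lam = 0` where `U` vanishes, follows by replacing
`q` with `s q` and letting `s` increase to `1`; only finite sums are involved. -/
theorem lubich_form_ge {γ lam τ : ℝ} (h0 : 0 < γ) (h1 : γ < 1)
    (hlam : 0 ≤ lam * τ) {q : ℂ} (hq : ‖q‖ ≤ Real.exp (-lam * τ)) (N : ℕ) (v : ℕ → ℂ) :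
    temperConst γ lam τ * ∑ n ∈ Finset.range N, ‖v n‖ ^ 2 ≤
      (∑ n ∈ Finset.range N, ∑ k ∈ Finset.range (n + 1),
        (lubich γ k : ℂ) * q ^ k * v (n - k) * (starRingEnd ℂ) (v n)).re := by
  have hc : Continuous fun s : ℝ => (∑ n ∈ Finset.range N, ∑ k ∈ Finset.range (n + 1),
      (lubich γ k : ℂ) * (s * q) ^ k * v (n - k) * (starRingEnd ℂ) (v n)).re := by fun_prop
  have ht := (hc.tendsto 1).mono_left (nhdsWithin_le_nhds (s := Set.Iio 1))
  simp only [Complex.ofReal_one, one_mul] at ht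
  refine ge_of_tendsto ht ?_
  filter_upwards [Ioo_mem_nhdsLT (show (0 : ℝ) < 1 by norm_num)] with s hs
  have hq1 : ‖q‖ ≤ 1 := hq.trans (Real.exp_le_one_iff.mpr (by linarith))
  have hn : ‖(s : ℂ) * q‖ = s * ‖q‖ := by
    rw [norm_mul, Complex.norm_real, Real.norm_of_nonneg hs.1.le]
  refine lubich_form_ge_of_norm_lt_one h0 h1 hlam ?_ ?_ N v
  · rw [hn]; nlinarith [norm_nonneg q, hs.1, hs.2]
  · rw [hn]; nlinarith [norm_nonneg q, hs.1, hs.2]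

/-! ### Coercivity of the space discretization -/

theorem add_one_mul_grunwald (s : ℝ) (n : ℕ) :
    ((n : ℝ) + 1) * grunwald s (n + 1) = (n - s) * grunwald s n := by
  have : (n : ℝ) + 1 ≠ 0 := by positivity
  rw [grunwald]
  push_cast
  field_simp
  ring

/-- Coefficient form of `d/dz (1 - z) ^ s = -s (1 - z) ^ (s - 1)`. -/
theorem add_one_mul_grunwald_eq (s : ℝ) (n : ℕ) :
    ((n : ℝ) + 1) * grunwald s (n + 1) = -s * grunwald (s - 1) n := by
  induction n with
  | zero => simp [grunwald]
  | succ n ih =>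
    have h1 := add_one_mul_grunwald s (n + 1)
    have h2 := add_one_mul_grunwald (s - 1) n
    have : (n : ℝ) + 1 ≠ 0 := by positivity
    apply mul_left_cancel₀ this
    push_cast at *
    linear_combination (n + 1 : ℝ) * h1 + (n + 1 - s) * ih + s * h2

/-- Taking partial sums divides the generating function by `1 - z`, which lowers the exponent by
one. -/
theorem sum_grunwald (s : ℝ) (m : ℕ) :
    ∑ k ∈ Finset.range (m + 1), grunwald s k = grunwald (s - 1) m := by
  induction m with
  | zero => simp [grunwald]
  | succ m ih =>
    have h1 := add_one_mul_grunwald_eq s m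
    have h2 := add_one_mul_grunwald (s - 1) m
    have : (m : ℝ) + 1 ≠ 0 := by positivity
    rw [Finset.sum_range_succ, ih]
    apply mul_left_cancel₀ this
    linear_combination h1 - h2

theorem sum_spaceWeight (α : ℝ) (m : ℕ) :
    ∑ k ∈ Finset.range (m + 2), spaceWeight α k =
      α / 2 * grunwald (α - 1) (m + 1) + (2 - α) / 2 * grunwald (α - 1) m := by
  rw [Finset.sum_range_succ']
  simp only [spaceWeight, Finset.sum_add_distrib, ← Finset.mul_sum]
  rw [sum_grunwald, ← sum_grunwald α (m + 1), Finset.sum_range_succ' _ (m + 1)]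
  ring

theorem grunwald_eq_Gamma {s : ℝ} (h0 : 0 < s) (h1 : s < 1) (m : ℕ) :
    grunwald s m = Real.Gamma (m - s) / (Real.Gamma (-s) * Real.Gamma (m + 1)) := by
  have hs : Real.Gamma (-s) ≠ 0 := Real.Gamma_ne_zero fun n h => by
    rcases n with _ | n
    · simp at h; linarith
    · push_cast at h; linarith [(Nat.cast_nonneg n : (0 : ℝ) ≤ n)]
  induction m with
  | zero => simp [grunwald, hs]
  | succ m ih =>
    have hm : (m : ℝ) + 1 ≠ 0 := by positivity
    have hms : (m : ℝ) - s ≠ 0 := by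
      rcases m with _ | m
      · simp [h0.ne']
      · push_cast; have := (Nat.cast_nonneg m : (0 : ℝ) ≤ m); intro h; linarith
    have hG : Real.Gamma (m + 1) ≠ 0 := (Real.Gamma_pos_of_pos (by positivity)).ne'
    rw [grunwald, ih]
    push_cast
    rw [Real.Gamma_add_one hm, show (m : ℝ) + 1 - s = (m - s) + 1 by ring, Real.Gamma_add_one hms]
    field_simp
    ring

/-- By logarithmic convexity of the Gamma function. -/
theorem rpow_neg_le_Gamma_div {x s : ℝ} (hs : 1 ≤ s) (hx : s - 1 < x) (hx0 : 0 < x) :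
    x ^ (-s) ≤ Real.Gamma (x + 1 - s) / Real.Gamma (x + 1) := by
  have hx1 : 0 < x + 1 - s := by linarith
  have g0 := Real.Gamma_pos_of_pos hx0
  have g1 : 0 < Real.Gamma (x + 1) := Real.Gamma_pos_of_pos (by linarith)
  have g2 := Real.Gamma_pos_of_pos hx1
  have hs0 : 0 < s := by linarith
  have hcv := Real.convexOn_log_Gamma.2
  have hc := hcv (x := x + 1 - s) hx1 (y := x + 1)
    (show (0 : ℝ) < x + 1 by linarith) (a := 1 / s) (b := (s - 1) / s) (by positivity)
    (div_nonneg (by linarith) hs0.le) (by field_simp; ring)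
  -- The point `x` is a convex combination of `x + 1 - s` and `x + 1`. With `Γ(x + 1) = x Γ(x)`, the
  -- convexity inequality for `log Γ` rearranges to the claim.
  have hxe : (1 / s) • (x + 1 - s) + ((s - 1) / s) • (x + 1) = x := by
    simp only [smul_eq_mul]; field_simp; ring
  rw [hxe] at hc
  simp only [Function.comp_apply, smul_eq_mul] at hc
  have hlog : Real.log (Real.Gamma (x + 1)) = Real.log x + Real.log (Real.Gamma x) := by
    rw [Real.Gamma_add_one hx0.ne', Real.log_mul hx0.ne' g0.ne']
  rw [← Real.log_le_log_iff (by positivity) (by positivity), Real.log_rpow hx0,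
    Real.log_div g2.ne' g1.ne']
  rw [show 1 / s * Real.log (Real.Gamma (x + 1 - s)) + (s - 1) / s * Real.log (Real.Gamma (x + 1))
    = (Real.log (Real.Gamma (x + 1 - s)) + (s - 1) * Real.log (Real.Gamma (x + 1))) / s by ring,
    le_div_iff₀ hs0] at hc
  nlinarith

/-- Since `1 - α` lies in `(-1, 0)`, `Γ(1 - α)` is negative; this turns the lower bound on the Gamma
quotient into a strictly negative upper bound. -/
theorem grunwald_le {α : ℝ} (h1 : 1 < α) (h2 : α < 2) {m : ℕ} (hm : 1 ≤ m) :
    grunwald (α - 1) m ≤ -((m : ℝ) ^ (-α) / |Real.Gamma (1 - α)|) := by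
  have hneg : Real.Gamma (1 - α) < 0 := by
    have h := Real.Gamma_add_one (s := 1 - α) (by linarith)
    have := Real.Gamma_pos_of_pos (show 0 < 1 - α + 1 by linarith)
    rw [h] at this
    by_contra hn
    nlinarith [not_lt.mp hn]
  have hm' : (1 : ℝ) ≤ m := by exact_mod_cast hm
  have h := rpow_neg_le_Gamma_div h1.le (x := m) (by linarith) (by linarith)
  rw [grunwald_eq_Gamma (by linarith) (by linarith), abs_of_neg hneg,
    show -(α - 1) = 1 - α by ring, show (m : ℝ) - (α - 1) = m + 1 - α by ring, div_neg, neg_neg,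
    mul_comm (Real.Gamma (1 - α)), ← div_div]
  exact div_le_div_of_nonpos_of_le hneg.le h

/-- The part of `spaceEntry` coming from the left derivative. -/
noncomputable def leftEntry (α : ℝ) (i j : ℕ) : ℝ :=
  if j ≤ i + 1 then spaceWeight α (i + 1 - j) else 0

/-- The two one-sided stencils overlap only on the diagonal and its two neighbours, because each is
shifted by one node. This is the source of the entries `2 w_1` and `w_0 + w_2`, and it makes the
symmetry evident. -/
theorem spaceEntry_eq (α : ℝ) (i j : ℕ) : spaceEntry α i j = leftEntry α i j + leftEntry α j i := by
  unfold spaceEntry leftEntry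
  split_ifs <;> first | omega | skip
  · rw [add_zero]; congr 1; omega
  · rw [add_comm]; congr 2 <;> omega
  · subst_vars; simp; ring
  · congr 2 <;> omega
  · rw [zero_add]; congr 1; omega

theorem spaceEntry_symm (α : ℝ) (i j : ℕ) : spaceEntry α i j = spaceEntry α j i := by
  rw [spaceEntry_eq, spaceEntry_eq, add_comm]

theorem sum_leftEntry_mul {α : ℝ} {i M : ℕ} (hi : i < M) (u : ℕ → ℂ) :
    ∑ j ∈ Finset.range (M + 1), (leftEntry α i j : ℂ) * u j =
      ∑ k ∈ Finset.range (i + 2), (spaceWeight α k : ℂ) * u (i + 1 - k) := by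
  have h := Finset.sum_range_reflect (fun k => (spaceWeight α k : ℂ) * u (i + 1 - k)) (i + 2)
  rw [← h, ← Finset.sum_subset (Finset.range_subset_range.mpr (show i + 2 ≤ M + 1 by omega))]
  · refine Finset.sum_congr rfl fun j hj => ?_
    have := Finset.mem_range.mp hj
    rw [leftEntry, if_pos (by omega)]
    congr 2; omega
  · intro j _ hj
    have := mt Finset.mem_range.mpr hj
    rw [leftEntry, if_neg (by omega)]; simp

theorem sum_leftEntry_swap_mul {α : ℝ} {i M : ℕ} (hi : i ≤ M) (hi0 : 0 < i) (u : ℕ → ℂ) :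
    ∑ j ∈ Finset.range (M + 1), (leftEntry α j i : ℂ) * u j =
      ∑ k ∈ Finset.range (M - i + 2), (spaceWeight α k : ℂ) * u (i - 1 + k) := by
  have h := Finset.sum_range_add_sum_Ico
    (fun j => (leftEntry α j i : ℂ) * u j) (show i - 1 ≤ M + 1 by omega)
  rw [← h, Finset.sum_eq_zero, zero_add, Finset.sum_Ico_eq_sum_range]
  · have : M + 1 - (i - 1) = M - i + 2 := by omega
    rw [this]
    refine Finset.sum_congr rfl fun k _ => ?_
    rw [leftEntry, if_pos (by omega)]
    congr 3; omega
  · intro j hj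
    have := Finset.mem_range.mp hj
    rw [leftEntry, if_neg (by omega)]; simp

/-- The partial sum is an average, with weights `α/2` and `(2 - α)/2`, of `grunwald (α - 1)` at `m +
1` and `m`. Both indices lie between `1` and `M`, so the decay bound at `M` applies to each. -/
theorem sum_spaceWeight_le {α : ℝ} (h1 : 1 < α) (h2 : α < 2) {m M : ℕ} (hm : 1 ≤ m) (hM : m < M) :
    ∑ k ∈ Finset.range (m + 2), spaceWeight α k ≤ -((M : ℝ) ^ (-α) / |Real.Gamma (1 - α)|) := by
  have hle : ∀ n : ℕ, 1 ≤ n → n ≤ M →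
      grunwald (α - 1) n ≤ -((M : ℝ) ^ (-α) / |Real.Gamma (1 - α)|) := by
    intro n hn hnM
    refine (grunwald_le h1 h2 hn).trans (neg_le_neg ?_)
    refine div_le_div_of_nonneg_right ?_ (abs_nonneg _)
    exact Real.rpow_le_rpow_of_nonpos (by exact_mod_cast hn) (by exact_mod_cast hnM) (by linarith)
  rw [sum_spaceWeight]
  nlinarith [hle m hm hM.le, hle (m + 1) (by omega) hM]

theorem sum_spaceEntry_le {α : ℝ} (h1 : 1 < α) (h2 : α < 2) {i M : ℕ} (hi : 0 < i) (hM : i < M) :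
    ∑ j ∈ Finset.range (M + 1), spaceEntry α i j ≤
      -(2 * (M : ℝ) ^ (-α) / |Real.Gamma (1 - α)|) := by
  have e1 := sum_leftEntry_mul (α := α) hM (fun _ => 1)
  have e2 := sum_leftEntry_swap_mul (α := α) hM.le hi (fun _ => 1)
  simp only [mul_one, ← Complex.ofReal_sum, Complex.ofReal_inj] at e1 e2
  simp_rw [spaceEntry_eq, Finset.sum_add_distrib]
  rw [e1, e2]
  have := sum_spaceWeight_le h1 h2 hi hM
  have := sum_spaceWeight_le h1 h2 (m := M - i) (M := M) (by omega) (by omega)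
  linarith [show 2 * (M : ℝ) ^ (-α) / |Real.Gamma (1 - α)| =
    (M : ℝ) ^ (-α) / |Real.Gamma (1 - α)| + (M : ℝ) ^ (-α) / |Real.Gamma (1 - α)| by ring]

/-- The binomial weights of order `α` are nonnegative from index two on. The index three here is
needed, since `w_2` is negative for `α` near one. -/
theorem spaceWeight_add_three_nonneg {α : ℝ} (h1 : 1 < α) (h2 : α < 2) (k : ℕ) :
    0 ≤ spaceWeight α (k + 3) := by
  have : ∀ k, 0 ≤ grunwald α (k + 2) := by
    intro k
    induction k with
    | zero => simp only [grunwald]; norm_num; nlinarith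
    | succ k ih =>
      rw [grunwald]
      refine mul_nonneg ?_ ih
      rw [sub_nonneg, div_le_one (by positivity)]
      push_cast; linarith [(Nat.cast_nonneg k : (0 : ℝ) ≤ k)]
  rw [spaceWeight]
  have hk := this k
  have hk1 : 0 ≤ grunwald α (k + 2 + 1) := this (k + 1)
  have : 0 ≤ (2 - α) / 2 := by linarith
  positivity

/-- The possibly negative `w_2` enters only next to the diagonal, where it is compensated: `w_0 +
w_2 = α (α + 2)(α - 1) / 4`. -/
theorem spaceEntry_nonneg {α : ℝ} (h1 : 1 < α) (h2 : α < 2) {i j : ℕ} (h : i ≠ j) :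
    0 ≤ spaceEntry α i j := by
  have hadj : 0 ≤ spaceWeight α 0 + spaceWeight α 2 := by
    have : spaceWeight α 0 + spaceWeight α 2 = α / 4 * ((α + 2) * (α - 1)) := by
      simp only [spaceWeight, grunwald]; norm_num; ring
    rw [this]
    have : 0 ≤ α - 1 := by linarith
    positivity
  unfold spaceEntry
  split_ifs with h3 h4 h5 h6
  · obtain ⟨k, hk⟩ : ∃ k, i - j + 1 = k + 3 := ⟨i - j - 2, by omega⟩
    rw [hk]; exact spaceWeight_add_three_nonneg h1 h2 k
  · exact hadj
  · exact absurd h5.symm h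
  · exact hadj
  · obtain ⟨k, hk⟩ : ∃ k, j - i + 1 = k + 3 := ⟨j - i - 2, by omega⟩
    rw [hk]; exact spaceWeight_add_three_nonneg h1 h2 k

/-- Coercivity of the discrete Riesz operator with homogeneous Dirichlet conditions. -/
theorem spaceEntry_form_le {α : ℝ} (h1 : 1 < α) (h2 : α < 2) {M : ℕ} {v : ℕ → ℂ}
    (h0 : v 0 = 0) (hM : v M = 0) :
    (∑ i ∈ Finset.Ioo 0 M, (∑ j ∈ Finset.range (M + 1), (spaceEntry α i j : ℂ) * v j) *
      (starRingEnd ℂ) (v i)).re ≤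
      -(2 * (M : ℝ) ^ (-α) / |Real.Gamma (1 - α)|) * ∑ i ∈ Finset.Ioo 0 M, ‖v i‖ ^ 2 := by
  have hext : ∀ f : ℕ → ℝ, f 0 = 0 → f M = 0 →
      ∑ i ∈ Finset.Ioo 0 M, f i = ∑ i ∈ Finset.range (M + 1), f i := by
    intro f hf0 hfM
    refine Finset.sum_subset (fun i hi => ?_) fun i hi hi' => ?_
    · simp only [Finset.mem_Ioo, Finset.mem_range] at *; omega
    · simp only [Finset.mem_Ioo, Finset.mem_range] at *
      rcases (show i = 0 ∨ i = M by omega) with rfl | rfl <;> assumption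
  -- Young's inequality needs a nonnegative coefficient. On the diagonal it is an equality, so the
  -- sign of the diagonal entry does not matter.
  have hterm : ∀ i j, ((spaceEntry α i j : ℂ) * v j * (starRingEnd ℂ) (v i)).re ≤
      spaceEntry α i j * ((‖v i‖ ^ 2 + ‖v j‖ ^ 2) / 2) := by
    intro i j
    rw [mul_assoc, Complex.re_ofReal_mul]
    by_cases hij : i = j
    · subst hij
      rw [Complex.mul_conj, Complex.normSq_eq_norm_sq, Complex.ofReal_re, add_self_div_two]
    · refine mul_le_mul_of_nonneg_left ?_ (spaceEntry_nonneg h1 h2 hij)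
      refine (Complex.re_le_norm _).trans ?_
      rw [norm_mul, RCLike.norm_conj]
      nlinarith [sq_nonneg (‖v i‖ - ‖v j‖)]
  have hsum : (∑ i ∈ Finset.Ioo 0 M, (∑ j ∈ Finset.range (M + 1), (spaceEntry α i j : ℂ) * v j) *
      (starRingEnd ℂ) (v i)).re ≤ ∑ i ∈ Finset.range (M + 1), ∑ j ∈ Finset.range (M + 1),
        spaceEntry α i j * ((‖v i‖ ^ 2 + ‖v j‖ ^ 2) / 2) := by
    rw [Complex.re_sum, hext _ (by simp [h0]) (by simp [hM])]
    refine Finset.sum_le_sum fun i _ => ?_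
    rw [Finset.sum_mul, Complex.re_sum]
    exact Finset.sum_le_sum fun j _ => hterm i j
  -- Symmetry of the matrix merges the two halves, leaving each `‖v i‖ ^ 2` weighted by its row sum.
  have hsym : ∑ i ∈ Finset.range (M + 1), ∑ j ∈ Finset.range (M + 1),
        spaceEntry α i j * ((‖v i‖ ^ 2 + ‖v j‖ ^ 2) / 2) =
      ∑ i ∈ Finset.range (M + 1), (∑ j ∈ Finset.range (M + 1), spaceEntry α i j) * ‖v i‖ ^ 2 := by
    have e1 : ∑ i ∈ Finset.range (M + 1), ∑ j ∈ Finset.range (M + 1), spaceEntry α i j * ‖v j‖ ^ 2 =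
        ∑ i ∈ Finset.range (M + 1), ∑ j ∈ Finset.range (M + 1), spaceEntry α i j * ‖v i‖ ^ 2 := by
      rw [Finset.sum_comm]
      exact Finset.sum_congr rfl fun i _ => Finset.sum_congr rfl fun j _ => by
        rw [spaceEntry_symm]
    simp_rw [Finset.sum_mul, add_div, mul_add, Finset.sum_add_distrib, mul_div_assoc',
      ← Finset.sum_div]
    rw [e1]; ring
  refine hsum.trans (hsym.trans_le ?_)
  rw [← hext _ (by simp [h0]) (by simp [hM]), Finset.mul_sum]
  refine Finset.sum_le_sum fun i hi => ?_
  have := Finset.mem_Ioo.mp hi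
  exact mul_le_mul_of_nonneg_right (sum_spaceEntry_le h1 h2 this.1 this.2) (sq_nonneg _)

/-! ### Stability of the scheme -/

/-- The generating factor `exp (-(λ + p U(x)) τ)` of the tempered weights. -/
theorem norm_exp_neg_rate_le (P : Problem) {x τ : ℝ} (hx : x ∈ Set.Ioo 0 P.b) (hτ : 0 < τ) :
    ‖Complex.exp (-P.rate x * τ)‖ ≤ Real.exp (-P.lam * τ) := by
  rw [Complex.norm_exp]
  refine Real.exp_le_exp.mpr ?_
  have h := mul_nonneg (mul_nonneg P.ρ_pos.le (P.U_nonneg x hx)) hτ.le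
  simp [Problem.rate]
  nlinarith

theorem Problem.kappa_pos (P : Problem) : 0 < P.kappa := by
  have h1 := P.one_lt_α
  have h2 := P.α_lt_two
  have hc : Real.cos (P.α * π / 2) < 0 := by
    apply Real.cos_neg_of_pi_div_two_lt_of_lt <;> nlinarith [Real.pi_pos]
  have : rieszConst P.α < 0 := one_div_neg.mpr (by linarith)
  have := P.K_pos
  unfold Problem.kappa
  nlinarith

theorem Problem.step_pos (P : Problem) {M : ℕ} (hM : 1 ≤ M) : 0 < P.step M :=
  div_pos P.b_pos (by exact_mod_cast hM)

theorem Problem.node_mem (P : Problem) {M i : ℕ} (hi : i ∈ Finset.Ioo 0 M) :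
    P.node M i ∈ Set.Ioo 0 P.b := by
  have h := Finset.mem_Ioo.mp hi
  have hM : (0 : ℝ) < M := by exact_mod_cast h.1.trans h.2
  have h1 : (0 : ℝ) < i := by exact_mod_cast h.1
  have h2 : (i : ℝ) < M := by exact_mod_cast h.2
  have hb := P.b_pos
  unfold Problem.node Problem.step
  refine ⟨by positivity, ?_⟩
  rw [mul_div_assoc', div_lt_iff₀ hM]
  nlinarith

theorem Problem.mem_Ioc_of_mem_Icc (P : Problem) {N n : ℕ} {τ : ℝ} (hτ : 0 < τ)
    (hT : N * τ ≤ P.T) (hn : n ∈ Finset.Icc 1 N) : (n : ℝ) * τ ∈ Set.Ioc 0 P.T := by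
  have h := Finset.mem_Icc.mp hn
  have h1 : (0 : ℝ) < n := by exact_mod_cast h.1
  have h2 : (n : ℝ) ≤ N := by exact_mod_cast h.2
  exact ⟨by positivity, by nlinarith⟩

theorem exp_neg_rate_mul (P : Problem) (x τ : ℝ) (k : ℕ) :
    Complex.exp (-P.rate x * (k * τ : ℝ)) = Complex.exp (-P.rate x * τ) ^ k := by
  rw [← Complex.exp_nat_mul]; push_cast; ring_nf

/-- The real damping and the phase combine into powers of one complex number, so at a fixed node the
time matrix is Toeplitz up to the tempering constant on the diagonal. -/
theorem timeCoeff_mul_exp (P : Problem) (τ x : ℝ) (k : ℕ) :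
    (P.timeCoeff τ x k : ℂ) * Complex.exp (-Complex.I * (P.η * P.U x * k * τ : ℝ)) =
      (lubich P.γ k : ℂ) * Complex.exp (-P.rate x * τ) ^ k -
        if k = 0 then (temperConst P.γ P.lam τ : ℂ) else 0 := by
  unfold Problem.timeCoeff
  split_ifs with h
  · subst h; simp
  · rw [← exp_neg_rate_mul, sub_zero, Problem.rate]
    push_cast
    rw [mul_comm (Complex.exp _) (lubich P.γ k : ℂ), mul_assoc, ← Complex.exp_add]
    congr 2; ring

/-- The equation satisfied by the error of the scheme. -/
theorem error_equation (P : Problem) {G : ℝ → ℝ → ℂ} (hG : P.IsSolution G) {M N : ℕ} {τ : ℝ}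
    {g : ℕ → ℕ → ℂ} (hg : P.IsSchemeSolution M N τ g)
    {n i : ℕ} (hn : n ∈ Finset.Icc 1 N) (hi : i ∈ Finset.Ioo 0 M) :
    P.truncationError G M τ i n =
      ((1 / τ ^ P.γ : ℝ) : ℂ) * (∑ k ∈ Finset.range (n + 1), (lubich P.γ k : ℂ) *
        Complex.exp (-P.rate (P.node M i) * τ) ^ k * P.error G M τ g (n - k) i -
          (temperConst P.γ P.lam τ : ℂ) * P.error G M τ g n i) -
      ((P.kappa / P.step M ^ P.α : ℝ) : ℂ) * ∑ j ∈ Finset.range (M + 1),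
        (spaceEntry P.α i j : ℂ) * P.error G M τ g n j := by
  have h := hg.scheme n hn i hi
  have h0 : g i 0 = G (P.node M i) 0 := by
    rw [hg.initial i hi, hG.initial _ (P.node_mem hi)]
  simp_rw [timeCoeff_mul_exp, sub_mul, Finset.sum_sub_distrib] at h
  rw [Finset.sum_eq_single (s := Finset.range (n + 1)) (f := fun k => (if k = 0 then
    (temperConst P.γ P.lam τ : ℂ) else 0) * g i (n - k)) 0 (fun k _ hk => by simp [hk])
    (by simp)] at h
  -- The two exponential factors multiply to one independent of `k`, so the initial-value terms of
  -- the truncation error agree with those of the scheme and cancel.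
  have hc : ∑ k ∈ Finset.range (n + 1), Complex.exp (-P.rate (P.node M i) * (k * τ : ℝ)) *
      (lubich P.γ k : ℂ) * (Complex.exp (-P.rate (P.node M i) * ((n - k : ℕ) * τ : ℝ)) *
        G (P.node M i) 0) = ∑ k ∈ Finset.range (n + 1), (lubich P.γ k : ℂ) *
          Complex.exp (-P.rate (P.node M i) * (n * τ : ℝ)) * g i 0 := by
    refine Finset.sum_congr rfl fun k hk => ?_
    simp_rw [exp_neg_rate_mul, h0]
    rw [← pow_mul_pow_sub _ (Nat.lt_succ_iff.mp (Finset.mem_range.mp hk))]; ring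
  have hd : ∑ k ∈ Finset.range (n + 1), Complex.exp (-P.rate (P.node M i) * (k * τ : ℝ)) *
      (lubich P.γ k : ℂ) * G (P.node M i) ((n - k : ℕ) * τ) =
      ∑ k ∈ Finset.range (n + 1), (lubich P.γ k : ℂ) *
        Complex.exp (-P.rate (P.node M i) * τ) ^ k * G (P.node M i) ((n - k : ℕ) * τ) := by
    refine Finset.sum_congr rfl fun k hk => ?_
    rw [exp_neg_rate_mul]; ring
  unfold Problem.truncationError
  rw [hc, hd]
  simp only [Problem.error, mul_sub, Finset.sum_sub_distrib]
  simp only [Problem.kappa, if_true, Nat.sub_zero] at h ⊢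
  push_cast at h ⊢
  linear_combination h

/-- Cauchy-Schwarz in `n` gives `Y² ≤ N ∑∑ a²`, and in `i` it gives `∑∑ a ≤ √M Y`. The hypothesis
then reads `c Y² ≤ N R √M Y`, and `Y` is cancelled. -/
theorem sum_sqrt_le_of_sum_sq_le {N M : ℕ} {c R : ℝ} (hc : 0 < c) (hR : 0 ≤ R) (a : ℕ → ℕ → ℝ)
    (h : c * ∑ n ∈ Finset.Icc 1 N, ∑ i ∈ Finset.Ioo 0 M, a n i ^ 2 ≤
      R * ∑ n ∈ Finset.Icc 1 N, ∑ i ∈ Finset.Ioo 0 M, a n i) :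
    c * ∑ n ∈ Finset.Icc 1 N, √(∑ i ∈ Finset.Ioo 0 M, a n i ^ 2) ≤ N * R * √M := by
  set Y := ∑ n ∈ Finset.Icc 1 N, √(∑ i ∈ Finset.Ioo 0 M, a n i ^ 2) with hY
  have hY0 : 0 ≤ Y := Finset.sum_nonneg fun _ _ => Real.sqrt_nonneg _
  have h1 : Y ^ 2 ≤ N * ∑ n ∈ Finset.Icc 1 N, ∑ i ∈ Finset.Ioo 0 M, a n i ^ 2 := by
    have := sq_sum_le_card_mul_sum_sq (s := Finset.Icc 1 N)
      (f := fun n => √(∑ i ∈ Finset.Ioo 0 M, a n i ^ 2))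
    rw [Nat.card_Icc, Nat.add_sub_cancel] at this
    refine this.trans_eq ?_
    congr 1
    exact Finset.sum_congr rfl fun n _ => Real.sq_sqrt (Finset.sum_nonneg fun _ _ => sq_nonneg _)
  have h2 : ∑ n ∈ Finset.Icc 1 N, ∑ i ∈ Finset.Ioo 0 M, a n i ≤ √M * Y := by
    rw [hY, Finset.mul_sum]
    refine Finset.sum_le_sum fun n _ => ?_
    rw [← Real.sqrt_mul (Nat.cast_nonneg M)]
    refine Real.le_sqrt_of_sq_le ?_
    refine (sq_sum_le_card_mul_sum_sq).trans ?_
    refine mul_le_mul_of_nonneg_right ?_ (Finset.sum_nonneg fun _ _ => sq_nonneg _)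
    rw [Nat.card_Ioo]; exact_mod_cast (by omega : M - 0 - 1 ≤ M)
  rcases hY0.eq_or_lt with h0 | h0
  · rw [← h0]; have := Real.sqrt_nonneg (M : ℝ); rw [mul_zero]; positivity
  · have h3 : c * Y * Y ≤ (N * R * √M) * Y := by
      calc c * Y * Y = c * Y ^ 2 := by ring
        _ ≤ c * (N * ∑ n ∈ Finset.Icc 1 N, ∑ i ∈ Finset.Ioo 0 M, a n i ^ 2) := by gcongr
        _ = N * (c * ∑ n ∈ Finset.Icc 1 N, ∑ i ∈ Finset.Ioo 0 M, a n i ^ 2) := by ring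
        _ ≤ N * (R * (√M * Y)) := mul_le_mul_of_nonneg_left
            (h.trans (mul_le_mul_of_nonneg_left h2 hR)) (Nat.cast_nonneg N)
        _ = _ := by ring
    exact le_of_mul_le_mul_right h3 h0

/-- Stability of the scheme: a bound of the local truncation error bounds the error. -/
theorem errorBound_of_truncationBound (P : Problem) {G : ℝ → ℝ → ℂ} (hG : P.IsSolution G)
    {C : ℝ} (hC : 0 < C) {M N : ℕ} (hM : 1 ≤ M) {τ : ℝ} (hτ : 0 < τ) (hT : N * τ ≤ P.T)
    (hr : P.TruncationBound G C M N τ) {g : ℕ → ℕ → ℂ} (hg : P.IsSchemeSolution M N τ g) :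
    P.ErrorBound G C M N τ g := by
  set ε := P.error G M τ g with hε
  set R := C * (τ ^ 2 + P.step M ^ 2) with hR
  have hh := P.step_pos hM
  have hκ := P.kappa_pos
  have hb := P.b_pos
  have hMpos : (0 : ℝ) < M := by exact_mod_cast hM
  have hΓ : 0 < |Real.Gamma (1 - P.α)| := by
    refine abs_pos.mpr (Real.Gamma_ne_zero fun n hn => ?_)
    have h1 := P.one_lt_α
    have h2 := P.α_lt_two
    have h3 : (n : ℝ) = P.α - 1 := by linarith
    have h4 : (0 : ℝ) < n := by linarith
    have h5 : (n : ℝ) < 1 := by linarith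
    have h6 : n < 1 := by exact_mod_cast h5
    have h7 : 0 < n := by exact_mod_cast h4
    omega
  have hε0 : ∀ i ∈ Finset.Ioo 0 M, ε 0 i = 0 := by
    intro i hi
    simp [hε, Problem.error, hg.initial i hi, hG.initial _ (P.node_mem hi)]
  have hbd : ∀ n ∈ Finset.Icc 1 N, ε n 0 = 0 ∧ ε n M = 0 := by
    intro n hn
    have ht := P.mem_Ioc_of_mem_Icc hτ hT hn
    constructor
    · rw [hε, Problem.error, (hg.boundary n hn).1, hG.boundary _ _ _ ht, sub_zero]
      simp [Problem.node]
    · rw [hε, Problem.error, (hg.boundary n hn).2, hG.boundary _ _ _ ht, sub_zero]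
      simp [Problem.node, Problem.step, mul_div_cancel₀ _ hMpos.ne']
  -- The coercivity constant `κ h^(-α) · 2 M^(-α) / |Γ(1 - α)|`, in which `h M = b` removes the
  -- mesh.
  set c := 2 * P.kappa / (P.b ^ P.α * |Real.Gamma (1 - P.α)|) with hc
  have hcpos : 0 < c := by positivity
  set F : ℕ → ℕ → ℂ := fun n i => (∑ k ∈ Finset.range (n + 1), (lubich P.γ k : ℂ) *
        Complex.exp (-P.rate (P.node M i) * τ) ^ k * ε (n - k) i -
          (temperConst P.γ P.lam τ : ℂ) * ε n i) * (starRingEnd ℂ) (ε n i) with hF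
  -- nonnegativity of the time part
  have htime : ∀ i ∈ Finset.Ioo 0 M, 0 ≤ ∑ n ∈ Finset.Icc 1 N, (F n i).re := by
    intro i hi
    -- The form starts at level zero, whereas the energy sum starts at level one; the initial error
    -- vanishes, so the extra term is zero.
    have h := lubich_form_ge P.γ_pos P.γ_lt_one (mul_nonneg P.lam_nonneg hτ.le)
      (norm_exp_neg_rate_le P (P.node_mem hi) hτ) (N + 1) (fun n => ε n i)
    have h0 : (F 0 i).re = 0 := by simp [hF, hε0 i hi]
    have h1 : ∑ n ∈ Finset.Icc 1 N, (F n i).re = ∑ n ∈ Finset.range (N + 1), (F n i).re := by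
      refine Finset.sum_subset (fun n hn => ?_) fun n hn hn' => ?_
      · simp only [Finset.mem_Icc, Finset.mem_range] at *; omega
      · have : n = 0 := by simp only [Finset.mem_Icc, Finset.mem_range] at *; omega
        rw [this, h0]
    rw [h1, ← Complex.re_sum]
    have h2 : ∀ n, F n i = ∑ k ∈ Finset.range (n + 1), (lubich P.γ k : ℂ) *
        Complex.exp (-P.rate (P.node M i) * τ) ^ k * ε (n - k) i * (starRingEnd ℂ) (ε n i) -
          ((temperConst P.γ P.lam τ * ‖ε n i‖ ^ 2 : ℝ) : ℂ) := by
      intro n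
      simp only [hF, sub_mul, Finset.sum_mul]
      congr 1
      rw [mul_assoc, Complex.mul_conj, Complex.normSq_eq_norm_sq]; push_cast; rfl
    simp_rw [h2, Finset.sum_sub_distrib, Complex.sub_re]
    rw [← Complex.ofReal_sum, Complex.ofReal_re, ← Finset.mul_sum]
    linarith
  have hspace : ∀ n ∈ Finset.Icc 1 N, c * ∑ i ∈ Finset.Ioo 0 M, ‖ε n i‖ ^ 2 ≤
      -(P.kappa / P.step M ^ P.α) * ∑ i ∈ Finset.Ioo 0 M,
        ((∑ j ∈ Finset.range (M + 1), (spaceEntry P.α i j : ℂ) * ε n j) *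
          (starRingEnd ℂ) (ε n i)).re := by
    intro n hn
    have h := spaceEntry_form_le P.one_lt_α P.α_lt_two (hbd n hn).1 (hbd n hn).2
    rw [Complex.re_sum] at h
    have hpos : 0 ≤ P.kappa / P.step M ^ P.α := by positivity
    have h' := mul_le_mul_of_nonneg_left h hpos
    have e : P.kappa / P.step M ^ P.α * (2 * (M : ℝ) ^ (-P.α) / |Real.Gamma (1 - P.α)|) = c := by
      rw [hc, Problem.step, Real.div_rpow hb.le hMpos.le, Real.rpow_neg hMpos.le]
      field_simp
    rw [← e]
    linarith
  have hmain : c * ∑ n ∈ Finset.Icc 1 N, ∑ i ∈ Finset.Ioo 0 M, ‖ε n i‖ ^ 2 ≤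
      R * ∑ n ∈ Finset.Icc 1 N, ∑ i ∈ Finset.Ioo 0 M, ‖ε n i‖ := by
    have hupper : ∑ n ∈ Finset.Icc 1 N, ∑ i ∈ Finset.Ioo 0 M,
        (P.truncationError G M τ i n * (starRingEnd ℂ) (ε n i)).re ≤
        R * ∑ n ∈ Finset.Icc 1 N, ∑ i ∈ Finset.Ioo 0 M, ‖ε n i‖ := by
      simp_rw [Finset.mul_sum]
      refine Finset.sum_le_sum fun n hn => Finset.sum_le_sum fun i hi => ?_
      refine (Complex.re_le_norm _).trans ?_
      rw [norm_mul, RCLike.norm_conj]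
      exact mul_le_mul_of_nonneg_right (hr n hn i hi) (norm_nonneg _)
    refine le_trans ?_ hupper
    have heq : ∑ n ∈ Finset.Icc 1 N, ∑ i ∈ Finset.Ioo 0 M,
        (P.truncationError G M τ i n * (starRingEnd ℂ) (ε n i)).re =
        (1 / τ ^ P.γ) * ∑ i ∈ Finset.Ioo 0 M, ∑ n ∈ Finset.Icc 1 N, (F n i).re +
        ∑ n ∈ Finset.Icc 1 N, -(P.kappa / P.step M ^ P.α) * ∑ i ∈ Finset.Ioo 0 M,
        ((∑ j ∈ Finset.range (M + 1), (spaceEntry P.α i j : ℂ) * ε n j) *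
          (starRingEnd ℂ) (ε n i)).re := by
      rw [Finset.sum_comm (s := Finset.Ioo 0 M)]
      simp_rw [Finset.mul_sum, ← Finset.sum_add_distrib]
      refine Finset.sum_congr rfl fun n hn => Finset.sum_congr rfl fun i hi => ?_
      rw [error_equation P hG hg hn hi, sub_mul, mul_assoc, mul_assoc, Complex.sub_re,
        Complex.re_ofReal_mul, Complex.re_ofReal_mul]
      ring
    rw [heq, Finset.mul_sum]
    have h1 := Finset.sum_le_sum hspace
    have h2 : 0 ≤ (1 / τ ^ P.γ) * ∑ i ∈ Finset.Ioo 0 M, ∑ n ∈ Finset.Icc 1 N, (F n i).re :=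
      mul_nonneg (by positivity) (Finset.sum_nonneg htime)
    linarith
  have hfin := sum_sqrt_le_of_sum_sq_le hcpos (by positivity : 0 ≤ R) (fun n i => ‖ε n i‖)
    hmain
  unfold Problem.ErrorBound discreteNorm
  simp_rw [Real.sqrt_mul hh.le, ← Finset.mul_sum]
  set Y := ∑ n ∈ Finset.Icc 1 N, √(∑ i ∈ Finset.Ioo 0 M, ‖ε n i‖ ^ 2)
  have hY : Y ≤ N * R * √M / c := by rw [le_div_iff₀ hcpos]; linarith
  have hsq : √(P.step M) * √M = √P.b := by
    rw [← Real.sqrt_mul hh.le, Problem.step, div_mul_cancel₀ _ hMpos.ne']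
  calc τ * (√(P.step M) * Y) ≤ τ * (√(P.step M) * (N * R * √M / c)) := by gcongr
    _ = (N * τ) * (R * (√(P.step M) * √M) / c) := by ring
    _ ≤ P.T * (R * (√(P.step M) * √M) / c) := by
        refine mul_le_mul_of_nonneg_right hT (by positivity)
    _ = _ := by
        rw [hsq, Real.rpow_add hb, ← Real.sqrt_eq_rpow, hc, hR]
        field_simp

/-! ### Fractional integrals on the Fourier side -/

/-- The symbol `μ + 2 π i w` of the operator `d/dt + μ`. -/
noncomputable def symbol (μ : ℂ) (w : ℝ) : ℂ := μ + 2 * π * Complex.I * (w : ℂ)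

/-- The plane wave `exp (2 π i w y)`. -/
noncomputable def wave (y w : ℝ) : ℂ := Complex.exp (2 * π * Complex.I * (w : ℂ) * (y : ℂ))

theorem norm_wave (y w : ℝ) : ‖wave y w‖ = 1 := by
  rw [wave, show 2 * π * Complex.I * (w : ℂ) * (y : ℂ) = ((2 * π * w * y : ℝ) : ℂ) * Complex.I by
    push_cast; ring, Complex.norm_exp_ofReal_mul_I]

theorem wave_sub (y x w : ℝ) :
    wave (y - x) w = wave y w * Complex.exp (-(2 * π * Complex.I * (w : ℂ)) * x) := by
  rw [wave, wave, ← Complex.exp_add]; push_cast; ring_nf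

@[fun_prop]
theorem continuous_wave (y : ℝ) : Continuous (wave y) := by unfold wave; fun_prop

@[fun_prop]
theorem continuous_symbol (μ : ℂ) : Continuous (symbol μ) := by unfold symbol; fun_prop

theorem symbol_re (μ : ℂ) (w : ℝ) : (symbol μ w).re = μ.re := by simp [symbol]

theorem symbol_im (μ : ℂ) (w : ℝ) : (symbol μ w).im = μ.im + 2 * π * w := by simp [symbol]

theorem integrable_wave_mul {f : ℝ → ℂ} (hf : Integrable f) (y : ℝ) :
    Integrable fun w => wave y w * f w := by
  refine hf.bdd_mul (c := 1) (continuous_wave y).aestronglyMeasurable ?_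
  exact .of_forall fun w => (norm_wave y w).le

/-- Fourier inversion. -/
theorem eq_integral_wave_mul_fourier {V : ℝ → ℂ} (hc : Continuous V) (hi : Integrable V)
    (hF : Integrable (𝓕 V)) (y : ℝ) : V y = ∫ w, wave y w * 𝓕 V w := by
  conv_lhs => rw [← hc.fourierInv_fourier_eq hi hF]
  rw [Real.fourierInv_eq']
  refine integral_congr_ae (.of_forall fun w => ?_)
  simp only [wave, smul_eq_mul, RCLike.inner_apply, conj_trivial]
  congr 2; push_cast; ring

theorem norm_le_integral_norm_fourier {V : ℝ → ℂ} (hc : Continuous V) (hi : Integrable V)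
    (hF : Integrable (𝓕 V)) (y : ℝ) : ‖V y‖ ≤ ∫ w, ‖𝓕 V w‖ := by
  rw [eq_integral_wave_mul_fourier hc hi hF y]
  refine (norm_integral_le_integral_norm _).trans_eq ?_
  simp_rw [norm_mul, norm_wave, one_mul]

theorem integrableOn_rpow_mul_exp_neg {s r : ℝ} (hs : 0 < s) (hr : 0 < r) :
    IntegrableOn (fun x : ℝ => x ^ (s - 1) * Real.exp (-r * x)) (Set.Ioi 0) := by
  have := integrableOn_rpow_mul_exp_neg_mul_rpow (p := 1) (s := s - 1) (by linarith) one_pos hr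
  simpa using this

theorem norm_kernel {s x : ℝ} {r : ℂ} (hx : 0 < x) :
    ‖((x ^ (s - 1) : ℝ) : ℂ) * Complex.exp (-r * x)‖ = x ^ (s - 1) * Real.exp (-r.re * x) := by
  rw [norm_mul, Complex.norm_real, Real.norm_of_nonneg (Real.rpow_nonneg hx.le _),
    Complex.norm_exp]
  simp

theorem measurable_kernel (s : ℝ) (r : ℂ) :
    Measurable fun x : ℝ => ((x ^ (s - 1) : ℝ) : ℂ) * Complex.exp (-r * x) := by fun_prop

theorem integrableOn_kernel {s : ℝ} (hs : 0 < s) {r : ℂ} (hr : 0 < r.re) :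
    IntegrableOn (fun x : ℝ => ((x ^ (s - 1) : ℝ) : ℂ) * Complex.exp (-r * x)) (Set.Ioi 0) := by
  refine (integrableOn_rpow_mul_exp_neg hs hr).mono' (measurable_kernel s r).aestronglyMeasurable ?_
  filter_upwards [ae_restrict_mem measurableSet_Ioi] with x hx
  exact (norm_kernel hx).le

/-- The Gamma integral with a complex scale. -/
theorem integral_rpow_mul_cexp_neg {s : ℝ} (hs : 0 < s) {r : ℂ} (hr : 0 < r.re) :
    ∫ x in Set.Ioi (0 : ℝ), ((x ^ (s - 1) : ℝ) : ℂ) * Complex.exp (-r * x) =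
      Real.Gamma s * r ^ (-s : ℂ) := by
  set H : Set ℂ := {z | 0 < z.re} with hH
  have hHo : IsOpen H := isOpen_lt continuous_const Complex.continuous_re
  -- Both sides are holomorphic in `r` on the right half-plane, so the identity theorem extends the
  -- classical formula from real `r`.
  have hL : DifferentiableOn ℂ (fun r : ℂ => ∫ x in Set.Ioi (0 : ℝ),
      ((x ^ (s - 1) : ℝ) : ℂ) * Complex.exp (-r * x)) H := by
    intro z hz
    have hz2 : 0 < z.re / 2 := half_pos hz
    have hmem : Metric.ball z (z.re / 2) ∈ 𝓝 z := Metric.ball_mem_nhds _ hz2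
    have := hasDerivAt_integral_of_dominated_loc_of_deriv_le
      (μ := volume.restrict (Set.Ioi (0 : ℝ)))
      (F := fun (r : ℂ) (x : ℝ) => ((x ^ (s - 1) : ℝ) : ℂ) * Complex.exp (-r * x))
      (F' := fun (r : ℂ) (x : ℝ) => ((x ^ (s - 1) : ℝ) : ℂ) * (Complex.exp (-r * x) * (-x)))
      (bound := fun x => x ^ (s + 1 - 1) * Real.exp (-(z.re / 2) * x)) (x₀ := z) hmem
      (.of_forall fun r => (measurable_kernel s r).aestronglyMeasurable)
      (integrableOn_kernel hs hz)
      (by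
        have : Measurable fun x : ℝ => ((x ^ (s - 1) : ℝ) : ℂ) * (Complex.exp (-z * x) * (-x)) := by
          fun_prop
        exact this.aestronglyMeasurable)
      (by
        filter_upwards [ae_restrict_mem measurableSet_Ioi] with x hx r hr
        have hx' : (0 : ℝ) < x := hx
        have hre : z.re / 2 ≤ r.re := by
          have h1 : ‖r - z‖ < z.re / 2 := by simpa [dist_eq_norm] using hr
          have h2 := (abs_le.mp (Complex.abs_re_le_norm (r - z))).1
          simp only [Complex.sub_re] at h2; linarith
        rw [← mul_assoc, norm_mul, norm_kernel hx', norm_neg, Complex.norm_real,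
          Real.norm_of_nonneg hx'.le, show s + 1 - 1 = (s - 1) + 1 by ring,
          Real.rpow_add_one hx'.ne', mul_right_comm]
        gcongr)
      (integrableOn_rpow_mul_exp_neg (by linarith) hz2)
      (.of_forall fun x r _ => by
        have h1 : HasDerivAt (fun r : ℂ => -r * (x : ℂ)) (-x) r := by
          simpa using (hasDerivAt_id r).neg.mul_const (x : ℂ)
        exact (h1.cexp).const_mul _)
    exact this.2.differentiableAt.differentiableWithinAt
  have hR : DifferentiableOn ℂ (fun r : ℂ => (Real.Gamma s : ℂ) * r ^ (-s : ℂ)) H := by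
    intro z hz
    exact ((differentiableAt_id.cpow_const (Or.inl hz)).const_mul _).differentiableWithinAt
  have hpre : IsPreconnected H := (convex_halfSpace_re_gt 0).isPreconnected
  -- Agreement at real points `t > 1` accumulating at `1` is enough.
  have hfreq : ∃ᶠ z in 𝓝[≠] (1 : ℂ), (fun r : ℂ => ∫ x in Set.Ioi (0 : ℝ),
      ((x ^ (s - 1) : ℝ) : ℂ) * Complex.exp (-r * x)) z = (Real.Gamma s : ℂ) * z ^ (-s : ℂ) := by
    have ht : Tendsto (fun t : ℝ => (t : ℂ)) (𝓝[>] 1) (𝓝[≠] (1 : ℂ)) := by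
      refine tendsto_nhdsWithin_iff.mpr ⟨?_, ?_⟩
      · exact (Complex.continuous_ofReal.tendsto' 1 1 (by simp)).mono_left nhdsWithin_le_nhds
      · filter_upwards [self_mem_nhdsWithin] with t ht
        simpa using (ne_of_gt ht : t ≠ 1)
    refine ht.frequently (Eventually.frequently ?_)
    filter_upwards [self_mem_nhdsWithin] with t ht
    have ht0 : (0 : ℝ) < t := lt_trans one_pos ht
    have := Real.integral_rpow_mul_exp_neg_mul_Ioi hs ht0
    have h2 : ∀ x : ℝ, ((x ^ (s - 1) : ℝ) : ℂ) * Complex.exp (-(t : ℂ) * x) =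
        ((x ^ (s - 1) * Real.exp (-(t * x)) : ℝ) : ℂ) := by
      intro x; push_cast; congr 2; ring
    simp_rw [h2]
    rw [integral_complex_ofReal, this, one_div, Real.inv_rpow ht0.le, ← Real.rpow_neg ht0.le]
    push_cast [Complex.ofReal_cpow ht0.le]
    ring
  exact (hL.analyticOnNhd hHo).eqOn_of_preconnected_of_frequently_eq (hR.analyticOnNhd hHo) hpre
    (show (1 : ℂ) ∈ H by simp [hH]) hfreq hr

/-- Fractional integration of order `s`, with positive damping, on the Fourier side. -/
theorem fractional_integral_of_re_pos {V : ℝ → ℂ} (hc : Continuous V) (hi : Integrable V)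
    (hF : Integrable (𝓕 V)) {s : ℝ} (hs : 0 < s) {μ : ℂ} (hμ : 0 < μ.re) (y : ℝ) :
    ∫ x in Set.Ioi (0 : ℝ), ((x ^ (s - 1) : ℝ) : ℂ) * Complex.exp (-μ * x) * V (y - x) =
      Real.Gamma s * ∫ w, symbol μ w ^ (-s : ℂ) * (wave y w * 𝓕 V w) := by
  have h1 : ∀ x : ℝ, ((x ^ (s - 1) : ℝ) : ℂ) * Complex.exp (-μ * x) * V (y - x) =
      ∫ w, ((x ^ (s - 1) : ℝ) : ℂ) * Complex.exp (-μ * x) * (wave (y - x) w * 𝓕 V w) := by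
    intro x
    rw [eq_integral_wave_mul_fourier hc hi hF (y - x), integral_const_mul]
  simp_rw [h1]
  -- Fubini applies because the damped kernel and the Fourier transform are both integrable and the
  -- plane wave has modulus one.
  rw [integral_integral_swap]
  · rw [← integral_const_mul]
    refine integral_congr_ae (.of_forall fun w => ?_)
    simp only
    have h2 : ∀ x : ℝ, ((x ^ (s - 1) : ℝ) : ℂ) * Complex.exp (-μ * x) * (wave (y - x) w * 𝓕 V w) =
        ((x ^ (s - 1) : ℝ) : ℂ) * Complex.exp (-symbol μ w * x) * (wave y w * 𝓕 V w) := by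
      intro x
      rw [wave_sub, symbol, neg_add, add_mul, Complex.exp_add]; ring
    simp_rw [h2]
    rw [integral_mul_const, integral_rpow_mul_cexp_neg hs (by rwa [symbol_re])]
    ring
  · have h3 := (integrableOn_kernel hs hμ).mul_prod hF
    have h4 : AEStronglyMeasurable (fun p : ℝ × ℝ => wave (y - p.1) p.2)
        ((volume.restrict (Set.Ioi (0 : ℝ))).prod volume) := by
      unfold wave; exact Continuous.aestronglyMeasurable (by fun_prop)
    have h5 := h3.bdd_mul (c := 1) h4 (.of_forall fun p => (norm_wave _ _).le)
    refine h5.congr (.of_forall fun p => ?_)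
    simp only [Function.uncurry]; ring

theorem symbol_ne_zero_ae (μ : ℂ) : ∀ᵐ w : ℝ, symbol μ w ≠ 0 := by
  have : ∀ᵐ w : ℝ, w ≠ -μ.im / (2 * π) := by simp [ae_iff, measure_singleton]
  filter_upwards [this] with w hw h
  have := symbol_im μ w
  rw [h] at this
  apply hw
  have hpi := Real.pi_pos
  field_simp
  simp at this; linarith

theorem continuousAt_cpow_const_of_re_nonneg {z : ℂ} (hz : 0 ≤ z.re) (h0 : z ≠ 0) (s : ℂ) :
    ContinuousAt (fun z : ℂ => z ^ s) z := by
  refine continuousAt_cpow_const ?_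
  rcases hz.lt_or_eq with h | h
  · exact Or.inl h
  · exact Or.inr fun him => h0 (Complex.ext h.symm him)

theorem measurable_symbol_cpow (μ s : ℂ) : Measurable fun w => symbol μ w ^ s := by
  have := (continuous_symbol μ).measurable
  fun_prop

/-- The symbol of a fractional integral is integrable against a bounded integrable function. -/
theorem integrable_symbol_rpow_mul {f : ℝ → ℂ} (hf : Integrable f) {B : ℝ} (hB : ∀ w, ‖f w‖ ≤ B)
    {s : ℝ} (h0 : 0 < s) (h1 : s < 1) (μ : ℂ) :
    Integrable fun w => ‖symbol μ w‖ ^ (-s) * ‖f w‖ := by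
  -- The imaginary part of the symbol vanishes at `-m`, and `‖symbol μ w‖ ≥ |w + m|`. Close to `-m`
  -- the singularity `|w + m| ^ (-s)` is integrable and `f` is bounded by `B`; where the symbol has
  -- modulus at least one, the weight is at most one.
  set m : ℝ := μ.im / (2 * π)
  have hloc : Integrable (fun w : ℝ => (Set.Icc (-1 : ℝ) 1).indicator (fun v => |v| ^ (-s)) (w + m)) := by
    refine Integrable.comp_add_right (f := (Set.Icc (-1 : ℝ) 1).indicator (fun v => |v| ^ (-s))) ?_ m
    rw [integrable_indicator_iff measurableSet_Icc]
    have h2 : IntervalIntegrable (fun v : ℝ => |v| ^ (-s)) volume 0 1 := by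
      refine (intervalIntegral.intervalIntegrable_rpow' (a := 0) (b := 1) (r := -s) (by linarith)).congr ?_
      intro v hv
      rw [Set.uIoc_of_le zero_le_one] at hv
      simp [abs_of_pos hv.1]
    have h3 : IntervalIntegrable (fun v : ℝ => |v| ^ (-s)) volume (-1) 0 := by
      have := h2.comp_sub_left 0
      simp only [zero_sub, abs_neg, sub_zero] at this
      exact (by simpa using this.symm)
    exact (intervalIntegrable_iff_integrableOn_Icc_of_le (by norm_num)).mp (h3.trans h2)
  have hB0 : 0 ≤ B := (norm_nonneg _).trans (hB 0)
  refine ((hloc.mul_const B).add hf.norm).mono' ?_ ?_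
  · have := (continuous_symbol μ).measurable
    exact (Measurable.aestronglyMeasurable (by fun_prop)).mul hf.norm.aestronglyMeasurable
  · have hne : ∀ᵐ w : ℝ, w ≠ -m := by simp [ae_iff, measure_singleton]
    filter_upwards [hne] with w hw
    have hwm : 0 < |w + m| := abs_pos.mpr fun h => hw (by linarith)
    have him : |w + m| ≤ ‖symbol μ w‖ := by
      have h2 := Complex.abs_im_le_norm (symbol μ w)
      rw [symbol_im, show μ.im + 2 * π * w = (2 * π) * (w + m) by
        simp only [m]; field_simp; ring, abs_mul, abs_of_pos (by positivity)] at h2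
      nlinarith [abs_nonneg (w + m), Real.pi_gt_three]
    have hn : 0 < ‖symbol μ w‖ := hwm.trans_le him
    rw [Real.norm_of_nonneg (by positivity), Pi.add_apply]
    by_cases hle : 1 ≤ ‖symbol μ w‖
    · have h2 : ‖symbol μ w‖ ^ (-s) ≤ 1 := Real.rpow_le_one_of_one_le_of_nonpos hle (by linarith)
      have h3 : 0 ≤ (Set.Icc (-1 : ℝ) 1).indicator (fun v => |v| ^ (-s)) (w + m) :=
        Set.indicator_nonneg (fun v _ => by positivity) _
      nlinarith [norm_nonneg (f w), mul_nonneg h3 hB0]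
    · rw [not_le] at hle
      have hmem : w + m ∈ Set.Icc (-1 : ℝ) 1 := abs_le.mp (him.trans hle.le)
      rw [Set.indicator_of_mem hmem]
      have h2 : ‖symbol μ w‖ ^ (-s) ≤ |w + m| ^ (-s) :=
        Real.rpow_le_rpow_of_nonpos hwm him (by linarith)
      have h3 : ‖symbol μ w‖ ^ (-s) * ‖f w‖ ≤ |w + m| ^ (-s) * B := by gcongr; exact hB w
      linarith [norm_nonneg (f w)]

/-- Fractional integration of order `s ∈ (0, 1)` on the Fourier side. -/
theorem fractional_integral {V : ℝ → ℂ} (hc : Continuous V) (hi : Integrable V)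
    (hF : Integrable (𝓕 V)) {s : ℝ} (h0 : 0 < s) (h1 : s < 1) {μ : ℂ} (hμ : 0 ≤ μ.re) {y : ℝ}
    (hy : IntegrableOn (fun x : ℝ => ((x ^ (s - 1) : ℝ) : ℂ) * Complex.exp (-μ * x) * V (y - x))
      (Set.Ioi 0)) :
    ∫ x in Set.Ioi (0 : ℝ), ((x ^ (s - 1) : ℝ) : ℂ) * Complex.exp (-μ * x) * V (y - x) =
      Real.Gamma s * ∫ w, symbol μ w ^ (-s : ℂ) * (wave y w * 𝓕 V w) := by
  have hsym : ∀ (ε w : ℝ), symbol (μ + ε) w = symbol μ w + ε := fun ε w => by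
    simp only [symbol]; ring
  -- Damping `ε` is added and sent to zero. In physical space the undamped integrand dominates. In
  -- Fourier space `‖symbol + ε‖ ≥ ‖symbol‖`, because the real part is nonnegative, so the undamped
  -- singular weight dominates.
  have hl : Tendsto (fun ε : ℝ => ∫ x in Set.Ioi (0 : ℝ),
      ((x ^ (s - 1) : ℝ) : ℂ) * Complex.exp (-(μ + ε) * x) * V (y - x)) (𝓝[>] 0)
      (𝓝 (∫ x in Set.Ioi (0 : ℝ),
        ((x ^ (s - 1) : ℝ) : ℂ) * Complex.exp (-μ * x) * V (y - x))) := by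
    refine tendsto_integral_filter_of_dominated_convergence _ ?_ ?_ hy.norm ?_
    · refine .of_forall fun ε => ?_
      exact ((measurable_kernel s (μ + ε)).mul
        (hc.measurable.comp (measurable_const.sub measurable_id))).aestronglyMeasurable
    · filter_upwards [self_mem_nhdsWithin] with ε hε
      filter_upwards [ae_restrict_mem measurableSet_Ioi] with x hx
      have hx' : (0 : ℝ) < x := hx
      have hε' : (0 : ℝ) < ε := hε
      rw [norm_mul, norm_mul _ (V _), norm_kernel hx', norm_kernel hx']
      have : (μ + ε).re = μ.re + ε := by simp
      rw [this]
      gcongr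
      linarith
    · refine .of_forall fun x => ?_
      have : Continuous fun ε : ℝ =>
          ((x ^ (s - 1) : ℝ) : ℂ) * Complex.exp (-(μ + ε) * x) * V (y - x) := by fun_prop
      exact (this.tendsto' 0 _ (by simp)).mono_left nhdsWithin_le_nhds
  have hr : Tendsto (fun ε : ℝ => ∫ w, symbol (μ + ε) w ^ (-s : ℂ) * (wave y w * 𝓕 V w)) (𝓝[>] 0)
      (𝓝 (∫ w, symbol μ w ^ (-s : ℂ) * (wave y w * 𝓕 V w))) := by
    have hB : ∀ w, ‖𝓕 V w‖ ≤ ∫ v, ‖V v‖ := fun w =>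
      VectorFourier.norm_fourierIntegral_le_integral_norm _ _ _ _ _
    refine tendsto_integral_filter_of_dominated_convergence _ ?_ ?_
      (integrable_symbol_rpow_mul hF hB h0 h1 μ) ?_
    · exact .of_forall fun ε => (measurable_symbol_cpow _ _).aestronglyMeasurable.mul
        (integrable_wave_mul hF y).aestronglyMeasurable
    · filter_upwards [self_mem_nhdsWithin] with ε hε
      have hε' : (0 : ℝ) < ε := hε
      filter_upwards [symbol_ne_zero_ae μ] with w hw
      rw [norm_mul, norm_mul, norm_wave, one_mul, ← Complex.ofReal_neg, Complex.norm_cpow_real]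
      refine mul_le_mul_of_nonneg_right ?_ (norm_nonneg _)
      refine Real.rpow_le_rpow_of_nonpos (norm_pos_iff.mpr hw) ?_ (by linarith)
      rw [hsym, Complex.norm_def, Complex.norm_def]
      refine Real.sqrt_le_sqrt ?_
      have := symbol_re μ w
      simp only [Complex.normSq_apply, Complex.add_re, Complex.add_im, Complex.ofReal_re,
        Complex.ofReal_im]
      nlinarith
    · filter_upwards [symbol_ne_zero_ae μ] with w hw
      refine Tendsto.mul_const _ ?_
      have hcont := continuousAt_cpow_const_of_re_nonneg (by rwa [symbol_re]) hw (-s : ℂ)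
      refine hcont.tendsto.comp ?_
      have : Continuous fun ε : ℝ => symbol (μ + ε) w := by unfold symbol; fun_prop
      exact (this.tendsto' 0 _ (by simp)).mono_left nhdsWithin_le_nhds
  refine tendsto_nhds_unique hl ((hr.const_mul _).congr' ?_)
  filter_upwards [self_mem_nhdsWithin] with ε hε
  have hε' : (0 : ℝ) < ε := hε
  exact (fractional_integral_of_re_pos hc hi hF h0 (by simp; linarith) y).symm

/-- Differentiation of an inverse Fourier integral. -/
theorem hasDerivAt_integral_wave {f : ℝ → ℂ} (hf : Integrable f)
    (hf' : Integrable fun w : ℝ => (w : ℂ) * f w) (y : ℝ) :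
    HasDerivAt (fun y => ∫ w, wave y w * f w)
      (∫ w : ℝ, wave y w * (2 * π * Complex.I * w * f w)) y := by
  have hd : ∀ (w y : ℝ), HasDerivAt (fun y => wave y w) (wave y w * (2 * π * Complex.I * w)) y := by
    intro w y
    unfold wave
    have : HasDerivAt (fun y : ℝ => 2 * π * Complex.I * (w : ℂ) * (y : ℂ))
        (2 * π * Complex.I * (w : ℂ)) y := by
      simpa using (Complex.ofRealCLM.hasDerivAt (x := y)).const_mul (2 * π * Complex.I * (w : ℂ))
    exact this.cexp
  refine (hasDerivAt_integral_of_dominated_loc_of_deriv_le (μ := volume)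
    (F := fun (y w : ℝ) => wave y w * f w)
    (F' := fun (y w : ℝ) => wave y w * (2 * π * Complex.I * w * f w))
    (bound := fun (w : ℝ) => 2 * π * ‖(w : ℂ) * f w‖) (x₀ := y) (s := Set.univ) univ_mem
    (.of_forall fun y => (integrable_wave_mul hf y).aestronglyMeasurable)
    (integrable_wave_mul hf y) ?_ ?_ (hf'.norm.const_mul _) ?_).2
  · refine (integrable_wave_mul ((hf'.const_mul (2 * π * Complex.I)).congr ?_) y).aestronglyMeasurable
    exact .of_forall fun w => by simp only; ring
  · refine .of_forall fun w y _ => ?_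
    rw [norm_mul, norm_wave, one_mul, mul_assoc, norm_mul]
    simp [abs_of_pos Real.pi_pos]
  · refine .of_forall fun w y _ => ?_
    have := (hd w y).mul_const (f w)
    refine this.congr_deriv ?_
    ring

/-! ### Fractional derivatives on the Fourier side -/

theorem symbol_mul_cpow (μ : ℂ) (w : ℝ) {s : ℂ} (hs : s + 1 ≠ 0) :
    symbol μ w * symbol μ w ^ s = symbol μ w ^ (s + 1) := by
  by_cases h : symbol μ w = 0
  · rw [h, zero_mul, Complex.zero_cpow hs]
  · rw [Complex.cpow_add _ _ h, Complex.cpow_one, mul_comm]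

theorem aestronglyMeasurable_fourier {V : ℝ → ℂ} (hi : Integrable V) :
    AEStronglyMeasurable (𝓕 V) :=
  (VectorFourier.fourierIntegral_continuous Real.continuous_fourierChar
    (by exact continuous_inner) hi).aestronglyMeasurable

/-- Multiplication by a Fourier multiplier dominated by an integrable weight. -/
theorem integrable_mul_of_weight {f m : ℝ → ℂ} {W : ℝ → ℝ} (hf : AEStronglyMeasurable f)
    (hm : Measurable m) (hW : Integrable fun w => W w * ‖f w‖) (hle : ∀ w, ‖m w‖ ≤ W w) :
    Integrable fun w => m w * f w := by
  refine hW.mono' (hm.aestronglyMeasurable.mul hf) (.of_forall fun w => ?_)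
  rw [norm_mul]
  exact mul_le_mul_of_nonneg_right (hle w) (norm_nonneg _)

theorem rpow_le_one_add_rpow {x r p : ℝ} (hx : 0 ≤ x) (hr : 0 ≤ r) (hp : r ≤ p) :
    x ^ r ≤ (1 + x) ^ p :=
  (Real.rpow_le_rpow hx (by linarith) hr).trans (Real.rpow_le_rpow_of_exponent_le (by linarith) hp)

theorem integrable_symbol_cpow_mul {f : ℝ → ℂ} {p r : ℝ} {μ : ℂ} (hf : AEStronglyMeasurable f)
    (hW : Integrable fun w => (1 + ‖symbol μ w‖) ^ p * ‖f w‖) (hr : 0 ≤ r) (hp : r ≤ p) :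
    Integrable fun w => symbol μ w ^ (r : ℂ) * f w := by
  refine integrable_mul_of_weight hf (measurable_symbol_cpow μ r) hW fun w => ?_
  rw [Complex.norm_cpow_real]
  exact rpow_le_one_add_rpow (norm_nonneg _) hr hp

theorem integrable_of_weight {f : ℝ → ℂ} {p : ℝ} {μ : ℂ} (hf : AEStronglyMeasurable f)
    (hW : Integrable fun w => (1 + ‖symbol μ w‖) ^ p * ‖f w‖) (hp : 0 ≤ p) : Integrable f := by
  simpa using integrable_symbol_cpow_mul hf hW le_rfl hp

/-- The operator `d/dy + μ` acts on inverse Fourier integrals by multiplication with its symbol. -/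
theorem hasDerivAt_integral_wave_symbol {f : ℝ → ℂ} (μ : ℂ) (hf : Integrable f)
    (hf' : Integrable fun w => symbol μ w * f w) (y : ℝ) :
    HasDerivAt (fun y => ∫ w, wave y w * f w)
      ((∫ w, wave y w * (symbol μ w * f w)) - μ * ∫ w, wave y w * f w) y := by
  have hw : Integrable fun w : ℝ => (w : ℂ) * f w := by
    have := (hf'.sub (hf.const_mul μ)).const_mul (2 * π * Complex.I)⁻¹
    refine this.congr (.of_forall fun w => ?_)
    have hpi : (π : ℂ) ≠ 0 := by exact_mod_cast Real.pi_ne_zero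
    simp only [symbol, Pi.sub_apply]
    field_simp
    ring
  refine (hasDerivAt_integral_wave hf hw y).congr_deriv ?_
  rw [← integral_const_mul, ← integral_sub (integrable_wave_mul hf' y)
    ((integrable_wave_mul hf y).const_mul μ)]
  refine integral_congr_ae (.of_forall fun w => ?_)
  simp only [symbol]; ring

theorem integrable_fractional {V : ℝ → ℂ} (hF : Integrable (𝓕 V)) {s : ℝ}
    (h0 : 0 < s) (h1 : s < 1) (μ : ℂ) : Integrable fun w => symbol μ w ^ (-s : ℂ) * 𝓕 V w := by
  have hB : ∀ w, ‖𝓕 V w‖ ≤ ∫ v, ‖V v‖ := fun w =>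
    VectorFourier.norm_fourierIntegral_le_integral_norm _ _ _ _ _
  refine (integrable_symbol_rpow_mul hF hB h0 h1 μ).mono'
    ((measurable_symbol_cpow _ _).aestronglyMeasurable.mul hF.aestronglyMeasurable)
    (.of_forall fun w => ?_)
  rw [norm_mul, ← Complex.ofReal_neg, Complex.norm_cpow_real]

theorem setIntegral_Iio_eq (F : ℝ → ℂ) (y : ℝ) :
    ∫ ξ in Set.Iio y, F ξ = ∫ x in Set.Ioi (0 : ℝ), F (y - x) := by
  have := (Measure.measurePreserving_sub_left volume y).setIntegral_preimage_emb
    (Homeomorph.subLeft y).measurableEmbedding F (Set.Iio y)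
  simpa using this.symm

theorem integrableOn_Iio_iff (F : ℝ → ℂ) (y : ℝ) :
    IntegrableOn F (Set.Iio y) ↔ IntegrableOn (fun x => F (y - x)) (Set.Ioi 0) := by
  have := (Measure.measurePreserving_sub_left volume y).integrableOn_comp_preimage
    (Homeomorph.subLeft y).measurableEmbedding (f := F) (s := Set.Iio y)
  simpa [Function.comp_def] using this.symm

/-- The left derivative of a regular function on the Fourier side. -/
theorem HasLeftDeriv.eq_integral {α : ℝ} (h1 : 1 < α) (h2 : α < 2) {u : ℝ → ℂ} (hc : Continuous u)
    (hi : Integrable u) {p : ℝ} (hp : α ≤ p)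
    (hW : Integrable fun w => (1 + ‖symbol 0 w‖) ^ p * ‖𝓕 u w‖) {x : ℝ} {D : ℂ}
    (h : HasLeftDeriv α u x D) : D = ∫ w, wave x w * (symbol 0 w ^ (α : ℂ) * 𝓕 u w) := by
  have hm := aestronglyMeasurable_fourier hi
  have hF : Integrable (𝓕 u) := integrable_of_weight hm hW (by linarith)
  obtain ⟨hint, d, ⟨F', hF', hd⟩, rfl⟩ := h
  have hs0 : 0 < 2 - α := by linarith
  have hs1 : 2 - α < 1 := by linarith
  set f0 : ℝ → ℂ := fun w => symbol 0 w ^ (-(2 - α : ℝ) : ℂ) * 𝓕 u w with hf0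
  set f1 : ℝ → ℂ := fun w => symbol 0 w ^ ((α - 1 : ℝ) : ℂ) * 𝓕 u w with hf1
  set f2 : ℝ → ℂ := fun w => symbol 0 w ^ (α : ℂ) * 𝓕 u w with hf2
  have e1 : (fun w => symbol 0 w * f0 w) = f1 := by
    ext w
    have : (-(2 - α : ℝ) : ℂ) + 1 = ((α - 1 : ℝ) : ℂ) := by push_cast; ring
    rw [hf0, hf1]; simp only
    rw [← mul_assoc, symbol_mul_cpow _ _ (by rw [this]; exact_mod_cast (by linarith : α - 1 ≠ 0)),
      this]
  have e2 : (fun w => symbol 0 w * f1 w) = f2 := by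
    ext w
    have : ((α - 1 : ℝ) : ℂ) + 1 = (α : ℂ) := by push_cast; ring
    rw [hf1, hf2]; simp only
    rw [← mul_assoc, symbol_mul_cpow _ _ (by rw [this]; exact_mod_cast (by linarith : α ≠ 0)),
      this]
  have i0 : Integrable f0 := integrable_fractional hF hs0 hs1 0
  have i1 : Integrable f1 := integrable_symbol_cpow_mul hm hW (by linarith) (by linarith)
  have i2 : Integrable f2 := integrable_symbol_cpow_mul hm hW (by linarith) hp
  have hI : ∀ y, ∫ ξ in Set.Iio y, (((y - ξ) ^ (1 - α) : ℝ) : ℂ) * u ξ =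
      Real.Gamma (2 - α) * ∫ w, wave y w * f0 w := by
    intro y
    have hy := hint y
    rw [integrableOn_Iio_iff] at hy
    rw [setIntegral_Iio_eq]
    simp only [sub_sub_cancel] at hy ⊢
    have := fractional_integral hc hi hF hs0 hs1 (μ := 0) le_rfl (y := y)
    simp only [neg_zero, zero_mul, Complex.exp_zero, mul_one,
      show 2 - α - 1 = 1 - α by ring] at this
    rw [this hy]
    congr 1
    refine integral_congr_ae (.of_forall fun w => ?_)
    simp only [hf0]; ring
  have d1 : ∀ y, HasDerivAt (fun y => ∫ ξ in Set.Iio y, (((y - ξ) ^ (1 - α) : ℝ) : ℂ) * u ξ)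
      (Real.Gamma (2 - α) * ∫ w, wave y w * f1 w) y := by
    intro y
    have := hasDerivAt_integral_wave_symbol 0 i0 (by rw [e1]; exact i1) y
    simp only [zero_mul, sub_zero] at this
    rw [show (∫ w, wave y w * (symbol 0 w * f0 w)) = ∫ w, wave y w * f1 w by rw [← e1]] at this
    rw [funext hI]
    exact this.const_mul _
  have d2 : HasDerivAt (fun y => (Real.Gamma (2 - α) : ℂ) * ∫ w, wave y w * f1 w)
      (Real.Gamma (2 - α) * ∫ w, wave x w * f2 w) x := by
    have := hasDerivAt_integral_wave_symbol 0 i1 (by rw [e2]; exact i2) x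
    simp only [zero_mul, sub_zero] at this
    rw [show (∫ w, wave x w * (symbol 0 w * f1 w)) = ∫ w, wave x w * f2 w by rw [← e2]] at this
    exact this.const_mul _
  -- The given first derivative is known only near `x`; by uniqueness it coincides there with the
  -- Fourier expression, which can be differentiated once more.
  have hEq : F' =ᶠ[𝓝 x] fun y => (Real.Gamma (2 - α) : ℂ) * ∫ w, wave y w * f1 w :=
    hF'.mono fun y hy => hy.unique (d1 y)
  have : d = Real.Gamma (2 - α) * ∫ w, wave x w * f2 w := hd.unique (d2.congr_of_eventuallyEq hEq)
  change _ = ∫ w, wave x w * f2 w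
  rw [this]
  have hG : (Real.Gamma (2 - α) : ℂ) ≠ 0 := by exact_mod_cast (Real.Gamma_pos_of_pos hs0).ne'
  push_cast
  field_simp

/-- The right derivative is the left derivative of the reflected function. -/
theorem HasRightDeriv.comp_neg {α : ℝ} {u : ℝ → ℂ} {x : ℝ} {D : ℂ} (h : HasRightDeriv α u x D) :
    HasLeftDeriv α (fun y => u (-y)) (-x) D := by
  obtain ⟨hint, d, ⟨F', hF', hd⟩, rfl⟩ := h
  have hI : ∀ y, ∫ ξ in Set.Iio y, (((y - ξ) ^ (1 - α) : ℝ) : ℂ) * u (-ξ) =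
      ∫ ξ in Set.Ioi (-y), (((ξ - -y) ^ (1 - α) : ℝ) : ℂ) * u ξ := by
    intro y
    have := (Measure.measurePreserving_neg volume).setIntegral_preimage_emb
      (Homeomorph.neg ℝ).measurableEmbedding
      (fun ξ : ℝ => (((ξ - -y) ^ (1 - α) : ℝ) : ℂ) * u ξ) (Set.Ioi (-y))
    rw [← this]
    simp [neg_add_eq_sub]
  refine ⟨fun y => ?_, d, ⟨fun y => -F' (-y), ?_, ?_⟩, rfl⟩
  · have h1 := hint (-y)
    have := (Measure.measurePreserving_neg volume).integrableOn_comp_preimage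
      (Homeomorph.neg ℝ).measurableEmbedding (s := Set.Ioi (-y))
      (f := fun ξ : ℝ => (((ξ - -y) ^ (1 - α) : ℝ) : ℂ) * u ξ)
    have h2 := this.mpr h1
    simpa [Function.comp_def, neg_add_eq_sub] using h2
  · have ht : Tendsto (fun y : ℝ => -y) (𝓝 (-x)) (𝓝 x) := continuous_neg.tendsto' _ _ (neg_neg x)
    refine (ht.eventually hF').mono fun y hy => ?_
    rw [funext hI]
    have := HasDerivAt.scomp y hy (hasDerivAt_neg y)
    simpa [Function.comp_def] using this
  · have hd' : HasDerivAt F' d (-(-x)) := by rwa [neg_neg]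
    have := (HasDerivAt.scomp (-x) hd' (hasDerivAt_neg (-x))).fun_neg
    simpa [Function.comp_def] using this

/-- The substantial derivative of a regular function on the Fourier side. -/
theorem HasSubstantialDeriv.eq_integral {γ : ℝ} (h0 : 0 < γ) (h1 : γ < 1) {μ : ℂ} (hμ : 0 ≤ μ.re)
    {T : ℝ} {g V : ℝ → ℂ} (hc : Continuous V) (hi : Integrable V) (hneg : ∀ t < 0, V t = 0)
    (hg : ∀ t ∈ Set.Icc 0 T, V t = g t) {p : ℝ} (hp : γ ≤ p)
    (hW : Integrable fun w => (1 + ‖symbol μ w‖) ^ p * ‖𝓕 V w‖) {t : ℝ} (ht : t ∈ Set.Ioc 0 T)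
    {D : ℂ} (h : HasSubstantialDeriv γ μ T g t D) :
    D = ∫ w, wave t w * (symbol μ w ^ (γ : ℂ) * 𝓕 V w) := by
  have hm := aestronglyMeasurable_fourier hi
  have hF : Integrable (𝓕 V) := integrable_of_weight hm hW (by linarith)
  obtain ⟨hint, d, hd, rfl⟩ := h
  have hs0 : 0 < 1 - γ := by linarith
  have hs1 : 1 - γ < 1 := by linarith
  -- Vanishing on the whole negative axis, including `0` by continuity, lets the integral over `(0,
  -- y)` be read as one over the half-line.
  have hV0 : ∀ t ≤ 0, V t = 0 := by
    have hcl : IsClosed {t | V t = 0} := isClosed_eq hc continuous_const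
    have : Set.Iic (0 : ℝ) ⊆ {t | V t = 0} := by
      rw [← closure_Iio]; exact hcl.closure_subset_iff.mpr hneg
    exact this
  set f0 : ℝ → ℂ := fun w => symbol μ w ^ (-(1 - γ : ℝ) : ℂ) * 𝓕 V w with hf0
  set f1 : ℝ → ℂ := fun w => symbol μ w ^ (γ : ℂ) * 𝓕 V w with hf1
  have e1 : (fun w => symbol μ w * f0 w) = f1 := by
    ext w
    have : (-(1 - γ : ℝ) : ℂ) + 1 = (γ : ℂ) := by push_cast; ring
    rw [hf0, hf1]; simp only
    rw [← mul_assoc, symbol_mul_cpow _ _ (by rw [this]; exact_mod_cast h0.ne'), this]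
  have i0 : Integrable f0 := integrable_fractional hF hs0 hs1 μ
  have i1 : Integrable f1 := integrable_symbol_cpow_mul hm hW h0.le hp
  have hI : ∀ y ∈ Set.Icc 0 T, substantialIntegral γ μ g y =
      Real.Gamma (1 - γ) * ∫ w, wave y w * f0 w := by
    intro y hy
    set k : ℝ → ℂ := fun x => ((x ^ (1 - γ - 1) : ℝ) : ℂ) * Complex.exp (-μ * x) * V (y - x)
      with hk
    have hk0 : ∀ x ∈ Set.Ioi (0 : ℝ) \ Set.Ioc 0 y, k x = 0 := by
      intro x hx
      have : y - x ≤ 0 := by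
        by_contra hn
        exact hx.2 ⟨hx.1, by linarith⟩
      simp [hk, hV0 _ this]
    have hsub : ∀ z ∈ Set.uIcc 0 y, (((y - z) ^ (-γ) : ℝ) : ℂ) *
        Complex.exp (-μ * ((y - z : ℝ) : ℂ)) * g z = k (y - z) := by
      intro z hz
      rw [Set.uIcc_of_le hy.1] at hz
      simp only [hk, sub_sub_cancel, show 1 - γ - 1 = -γ by ring]
      rw [hg z ⟨hz.1, hz.2.trans hy.2⟩]
    have hki : IntegrableOn k (Set.Ioi 0) := by
      rcases hy.1.eq_or_lt with rfl | hy0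
      · refine integrableOn_zero.congr_fun (fun x hx => (hk0 x ⟨hx, by simp⟩).symm) measurableSet_Ioi
      · have h2 := (hint y ⟨hy0, hy.2⟩).congr (g := fun z => k (y - z))
          (fun z hz => hsub z (Set.uIoc_subset_uIcc hz))
        have h3 := h2.comp_sub_left y
        simp only [sub_sub_cancel, sub_zero, sub_self] at h3
        have h4 := (intervalIntegrable_iff_integrableOn_Ioc_of_le hy0.le).mp h3.symm
        exact h4.of_forall_sdiff_eq_zero measurableSet_Ioi hk0
    have h5 := fractional_integral hc hi hF hs0 hs1 hμ hki
    rw [substantialIntegral, intervalIntegral.integral_congr hsub,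
      intervalIntegral.integral_comp_sub_left k y, sub_self, sub_zero,
      intervalIntegral.integral_of_le hy.1,
      ← setIntegral_eq_of_subset_of_forall_sdiff_eq_zero measurableSet_Ioi
        (fun x hx => hx.1) hk0, h5]
    congr 1
    refine integral_congr_ae (.of_forall fun w => ?_)
    simp only [hf0]; ring
  have htI : t ∈ Set.Icc 0 T := ⟨ht.1.le, ht.2⟩
  have d1 := (hasDerivAt_integral_wave_symbol μ i0 (by rw [e1]; exact i1) t).const_mul
    (Real.Gamma (1 - γ) : ℂ)
  rw [show (∫ w, wave t w * (symbol μ w * f0 w)) = ∫ w, wave t w * f1 w by rw [← e1]] at d1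
  have d2 := d1.hasDerivWithinAt (s := Set.Icc 0 T) |>.congr hI (hI t htI)
  -- At `t = T` only the one-sided derivative is given; derivatives within a nondegenerate interval
  -- are still unique.
  have huniq : UniqueDiffWithinAt ℝ (Set.Icc 0 T) t := uniqueDiffOn_Icc (ht.1.trans_le ht.2) t htI
  change _ = ∫ w, wave t w * f1 w
  rw [huniq.eq_deriv _ hd d2, hI t htI]
  have hG : (Real.Gamma (1 - γ) : ℂ) ≠ 0 := by exact_mod_cast (Real.Gamma_pos_of_pos hs0).ne'
  push_cast
  field_simp
  ring

/-! ### Quadratures on the Fourier side -/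

theorem exp_neg_symbol_pow (μ : ℂ) (τ t w : ℝ) (k : ℕ) :
    Complex.exp (-symbol μ w * τ) ^ k * wave t w =
      Complex.exp (-μ * τ) ^ k * wave (t - k * τ) w := by
  rw [← Complex.exp_nat_mul, ← Complex.exp_nat_mul, wave, wave, ← Complex.exp_add,
    ← Complex.exp_add, symbol]
  push_cast; ring_nf

theorem norm_exp_neg_symbol (μ : ℂ) (τ w : ℝ) :
    ‖Complex.exp (-symbol μ w * τ)‖ = Real.exp (-μ.re * τ) := by
  rw [Complex.norm_exp]; simp [symbol_re]

/-- With positive damping, `exp (-symbol μ w τ)` has the same modulus below one at every frequency,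
so the series of `Φ` integrates termwise. Each power becomes a time shift by Fourier inversion, and
the shifts beyond `m` contribute nothing. -/
theorem sum_weights_of_re_pos {c : ℕ → ℝ} {Φ : ℂ → ℂ}
    (hΦ : ∀ z : ℂ, ‖z‖ < 1 → HasSum (fun k => (c k : ℂ) * z ^ k) (Φ z) ∧
      Summable fun k => ‖(c k : ℂ) * z ^ k‖)
    {V : ℝ → ℂ} (hc : Continuous V) (hi : Integrable V) (hF : Integrable (𝓕 V)) {μ : ℂ}
    (hμ : 0 < μ.re) {τ : ℝ} (hτ : 0 < τ) {t : ℝ} {m : ℕ}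
    (hV : ∀ k : ℕ, m ≤ k → V (t - k * τ) = 0) :
    ∑ k ∈ Finset.range m, (c k : ℂ) * Complex.exp (-μ * τ) ^ k * V (t - k * τ) =
      ∫ w, wave t w * (Φ (Complex.exp (-symbol μ w * τ)) * 𝓕 V w) := by
  set q := Complex.exp (-μ * τ) with hq
  have hqn : ∀ w, ‖Complex.exp (-symbol μ w * τ)‖ = ‖q‖ := fun w => by
    rw [norm_exp_neg_symbol, hq, Complex.norm_exp]; simp
  have hq1 : ‖q‖ < 1 := by
    rw [hq, Complex.norm_exp, Real.exp_lt_one_iff]; simp; positivity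
  set F : ℕ → ℝ → ℂ := fun k w =>
    (c k : ℂ) * Complex.exp (-symbol μ w * τ) ^ k * (wave t w * 𝓕 V w) with hFdef
  have hFe : ∀ k, F k = fun w => (c k : ℂ) * q ^ k * (wave (t - k * τ) w * 𝓕 V w) := by
    intro k; ext w
    simp only [hFdef]
    rw [mul_assoc, ← mul_assoc (_ ^ k), exp_neg_symbol_pow]; ring
  have hFi : ∀ k, Integrable (F k) := fun k => by
    rw [hFe]; exact (integrable_wave_mul hF _).const_mul _
  have hFn : ∀ k, ∫ w, ‖F k w‖ = ‖(c k : ℂ) * q ^ k‖ * ∫ w, ‖𝓕 V w‖ := by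
    intro k
    rw [hFe, ← integral_const_mul]
    simp_rw [norm_mul _ (wave _ _ * _), norm_mul (wave _ _), norm_wave, one_mul]
  have h := hasSum_integral_of_summable_integral_norm hFi
    (by simp_rw [hFn]; exact (hΦ q hq1).2.mul_right _)
  have h2 : ∀ k, ∫ w, F k w = (c k : ℂ) * q ^ k * V (t - k * τ) := by
    intro k
    rw [hFe, integral_const_mul, ← eq_integral_wave_mul_fourier hc hi hF]
  have h3 : ∀ w, ∑' k, F k w = wave t w * (Φ (Complex.exp (-symbol μ w * τ)) * 𝓕 V w) := by
    intro w
    have := (hΦ _ ((hqn w).trans_lt hq1)).1.mul_right (wave t w * 𝓕 V w)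
    rw [this.tsum_eq]; ring
  simp_rw [h2, h3] at h
  refine (hasSum_sum_of_ne_finset_zero fun k hk => ?_).unique h
  rw [hV k (by simpa using hk), mul_zero]

/-- A convolution quadrature on the Fourier side. -/
theorem sum_weights_eq_integral {c : ℕ → ℝ} {Φ : ℂ → ℂ}
    (hΦ : ∀ z : ℂ, ‖z‖ < 1 → HasSum (fun k => (c k : ℂ) * z ^ k) (Φ z) ∧
      Summable fun k => ‖(c k : ℂ) * z ^ k‖)
    (hcont : ContinuousOn Φ (Metric.closedBall 0 1))
    {V : ℝ → ℂ} (hc : Continuous V) (hi : Integrable V) (hF : Integrable (𝓕 V)) {μ : ℂ}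
    (hμ : 0 ≤ μ.re) {τ : ℝ} (hτ : 0 < τ) {t : ℝ} {m : ℕ}
    (hV : ∀ k : ℕ, m ≤ k → V (t - k * τ) = 0) :
    Integrable (fun w => Φ (Complex.exp (-symbol μ w * τ)) * 𝓕 V w) ∧
    ∑ k ∈ Finset.range m, (c k : ℂ) * Complex.exp (-μ * τ) ^ k * V (t - k * τ) =
      ∫ w, wave t w * (Φ (Complex.exp (-symbol μ w * τ)) * 𝓕 V w) := by
  obtain ⟨B, hB⟩ := (isCompact_closedBall (0 : ℂ) 1).exists_bound_of_continuousOn hcont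
  have hmem : ∀ ε : ℝ, 0 ≤ ε → ∀ w, Complex.exp (-symbol (μ + ε) w * τ) ∈
      Metric.closedBall (0 : ℂ) 1 := by
    intro ε hε w
    rw [mem_closedBall_zero_iff, norm_exp_neg_symbol, Real.exp_le_one_iff]
    simp only [Complex.add_re, Complex.ofReal_re]
    nlinarith
  have hcw : ∀ ε : ℝ, 0 ≤ ε →
      Continuous fun w => Φ (Complex.exp (-symbol (μ + ε) w * τ)) := fun ε hε =>
    hcont.comp_continuous (by fun_prop) (hmem ε hε)
  have hcw0 := hcw 0 le_rfl
  have hmem0 := hmem 0 le_rfl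
  simp only [Complex.ofReal_zero, add_zero] at hcw0 hmem0
  refine ⟨hF.bdd_mul (c := B) hcw0.aestronglyMeasurable (.of_forall fun w => hB _ (hmem0 w)), ?_⟩
  -- Vanishing damping again: continuity of `Φ` on the closed disc supplies both the uniform bound
  -- and the pointwise limit.
  have hl : Tendsto (fun ε : ℝ => ∑ k ∈ Finset.range m,
      (c k : ℂ) * Complex.exp (-(μ + ε) * τ) ^ k * V (t - k * τ)) (𝓝[>] 0)
      (𝓝 (∑ k ∈ Finset.range m, (c k : ℂ) * Complex.exp (-μ * τ) ^ k * V (t - k * τ))) := by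
    have : Continuous fun ε : ℝ => ∑ k ∈ Finset.range m,
      (c k : ℂ) * Complex.exp (-(μ + ε) * τ) ^ k * V (t - k * τ) := by fun_prop
    exact (this.tendsto' 0 _ (by simp)).mono_left nhdsWithin_le_nhds
  have hr : Tendsto (fun ε : ℝ =>
      ∫ w, wave t w * (Φ (Complex.exp (-symbol (μ + ε) w * τ)) * 𝓕 V w)) (𝓝[>] 0)
      (𝓝 (∫ w, wave t w * (Φ (Complex.exp (-symbol μ w * τ)) * 𝓕 V w))) := by
    refine tendsto_integral_filter_of_dominated_convergence (fun w => B * ‖𝓕 V w‖) ?_ ?_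
      (hF.norm.const_mul _) ?_
    · filter_upwards [self_mem_nhdsWithin] with ε hε
      exact (continuous_wave t).aestronglyMeasurable.mul
        ((hcw ε (le_of_lt hε)).aestronglyMeasurable.mul hF.aestronglyMeasurable)
    · filter_upwards [self_mem_nhdsWithin] with ε hε
      refine .of_forall fun w => ?_
      rw [norm_mul, norm_wave, one_mul, norm_mul]
      exact mul_le_mul_of_nonneg_right (hB _ (hmem ε (le_of_lt hε) w)) (norm_nonneg _)
    · refine .of_forall fun w => (Tendsto.mul_const _ ?_).const_mul _
      have h1 := (hcont _ (hmem0 w)).tendsto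
      refine h1.comp (tendsto_nhdsWithin_iff.mpr ⟨?_, ?_⟩)
      · have : Continuous fun ε : ℝ => Complex.exp (-symbol (μ + ε) w * τ) := by
          unfold symbol; fun_prop
        exact (this.tendsto' 0 _ (by simp)).mono_left nhdsWithin_le_nhds
      · filter_upwards [self_mem_nhdsWithin] with ε hε
        exact hmem ε (le_of_lt hε) w
  refine tendsto_nhds_unique hl (hr.congr' ?_)
  filter_upwards [self_mem_nhdsWithin] with ε hε
  have hε' : (0 : ℝ) < ε := hε
  exact (sum_weights_of_re_pos hΦ hc hi hF (by simp; linarith) hτ hV).symm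

/-! ### Consistency of the symbols -/

/-- Only one argument has to stay off the imaginary axis for the sum of arguments to remain in the
principal branch. The case `a = 0` is included because a symbol may vanish. -/
theorem mul_cpow_of_re_nonneg {a b : ℂ} (ha : 0 ≤ a.re) (hb : 0 < b.re) (s : ℂ) (hs : s ≠ 0) :
    (a * b) ^ s = a ^ s * b ^ s := by
  by_cases ha0 : a = 0
  · simp [ha0, Complex.zero_cpow hs]
  have h1 := abs_le.mp (Complex.abs_arg_le_pi_div_two_iff.mpr ha)
  have h2 := abs_lt.mp (Complex.abs_arg_lt_pi_div_two_iff.mpr (Or.inl hb))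
  have hb0 : b ≠ 0 := by rintro rfl; simp at hb
  rw [Complex.cpow_def_of_ne_zero ha0, Complex.cpow_def_of_ne_zero hb0,
    Complex.cpow_def_of_ne_zero (mul_ne_zero ha0 hb0), ← Complex.exp_add,
    Complex.log_mul ha0 hb0 ⟨by linarith, by linarith⟩, add_mul]

/-- A bounded symbol that is consistent of second order near the origin is so everywhere. -/
theorem exists_consistency_const {F : ℂ → ℂ} {S : Set ℂ} {β : ℝ} (hβ : 0 < β) {B : ℝ}
    (hB : ∀ z ∈ S, ‖F z‖ ≤ B) {E : ℂ → ℂ} (hE : E =O[𝓝 0] fun z => ‖z‖ ^ 2)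
    (h : ∀ᶠ z in 𝓝 0, z ∈ S → F z = z ^ (β : ℂ) * (1 + E z)) :
    ∃ C : ℝ, 0 ≤ C ∧ ∀ z ∈ S, ‖F z - z ^ (β : ℂ)‖ ≤ C * ‖z‖ ^ (β + 2) := by
  obtain ⟨C₀, hC₀, hEb⟩ := hE.exists_nonneg
  obtain ⟨r, hr, hball⟩ := Metric.eventually_nhds_iff.mp (h.and hEb.bound)
  refine ⟨C₀ + |B| / r ^ (β + 2) + 1 / r ^ 2, by positivity, fun z hz => ?_⟩
  have hz0 := norm_nonneg z
  have hsplit : ‖z‖ ^ (β + 2) = ‖z‖ ^ β * ‖z‖ ^ 2 := by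
    rw [Real.rpow_add_of_nonneg hz0 hβ.le (by norm_num), Real.rpow_two]
  have hP : 0 ≤ ‖z‖ ^ (β + 2) := by positivity
  -- Near the origin the expansion applies. Away from it `F` is bounded and `‖z‖ ^ β` grows more
  -- slowly, so each is separately at most a multiple of `‖z‖ ^ (β + 2)`.
  by_cases hzr : ‖z‖ < r
  · obtain ⟨h1, h2⟩ := hball (y := z) (by simpa using hzr)
    rw [h1 hz, mul_add, mul_one, add_sub_cancel_left, norm_mul, Complex.norm_cpow_real]
    simp only [norm_pow, norm_norm] at h2
    calc ‖z‖ ^ β * ‖E z‖ ≤ ‖z‖ ^ β * (C₀ * ‖z‖ ^ 2) := by gcongr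
      _ = C₀ * ‖z‖ ^ (β + 2) := by rw [hsplit]; ring
      _ ≤ _ := by
        refine mul_le_mul_of_nonneg_right ?_ hP
        have : 0 ≤ |B| / r ^ (β + 2) + 1 / r ^ 2 := by positivity
        linarith
  · rw [not_lt] at hzr
    have h1 : ‖F z‖ ≤ |B| / r ^ (β + 2) * ‖z‖ ^ (β + 2) := by
      have : r ^ (β + 2) ≤ ‖z‖ ^ (β + 2) := Real.rpow_le_rpow hr.le hzr (by linarith)
      have hrp : 0 < r ^ (β + 2) := by positivity
      rw [div_mul_eq_mul_div, le_div_iff₀ hrp]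
      exact mul_le_mul ((hB z hz).trans (le_abs_self B)) this hrp.le (abs_nonneg B)
    have h2 : ‖z ^ (β : ℂ)‖ ≤ 1 / r ^ 2 * ‖z‖ ^ (β + 2) := by
      rw [Complex.norm_cpow_real, hsplit, div_mul_eq_mul_div, one_mul, le_div_iff₀ (by positivity)]
      gcongr
    refine (norm_sub_le _ _).trans ?_
    have : 0 ≤ C₀ * ‖z‖ ^ (β + 2) := by positivity
    linarith [add_mul (C₀ + |B| / r ^ (β + 2)) (1 / r ^ 2) (‖z‖ ^ (β + 2)),
      add_mul C₀ (|B| / r ^ (β + 2)) (‖z‖ ^ (β + 2))]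

/-- The remainder of the quadratic Taylor polynomial of `exp (-z)`. -/
noncomputable def expRem (z : ℂ) : ℂ := Complex.exp (-z) - (1 - z + z ^ 2 / 2)

theorem isBigO_expRem : expRem =O[𝓝 0] fun z => ‖z‖ ^ 3 := by
  refine Asymptotics.IsBigO.of_bound 1 ?_
  filter_upwards [Metric.closedBall_mem_nhds (0 : ℂ) one_pos] with z hz
  have hz1 : ‖-z‖ ≤ 1 := by simpa using hz
  have h := Complex.exp_bound hz1 (n := 3) (by norm_num)
  have e : Complex.exp (-z) - ∑ m ∈ Finset.range 3, (-z) ^ m / (m.factorial : ℂ) = expRem z := by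
    simp [Finset.sum_range_succ, expRem, Nat.factorial]; ring
  rw [e, norm_neg] at h
  refine h.trans ?_
  simp only [norm_pow, norm_norm, one_mul]
  have : 0 ≤ ‖z‖ ^ 3 := by positivity
  norm_num [Nat.factorial]
  nlinarith

theorem isBigO_norm_pow {m n : ℕ} (h : n ≤ m) :
    (fun z : ℂ => ‖z‖ ^ m) =O[𝓝 0] fun z => ‖z‖ ^ n := by
  refine Asymptotics.IsBigO.of_bound 1 ?_
  filter_upwards [Metric.closedBall_mem_nhds (0 : ℂ) one_pos] with z hz
  have hz1 : ‖z‖ ≤ 1 := by simpa using hz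
  simp only [norm_pow, norm_norm, one_mul]
  exact pow_le_pow_of_le_one (norm_nonneg z) hz1 h

theorem isBigO_div_self {f : ℂ → ℂ} {n : ℕ} (h : f =O[𝓝 0] fun z => ‖z‖ ^ (n + 1)) :
    (fun z => f z / z) =O[𝓝 0] fun z => ‖z‖ ^ n := by
  obtain ⟨C, hC, hb⟩ := h.exists_nonneg
  refine Asymptotics.IsBigO.of_bound C ?_
  filter_upwards [hb.bound] with z hz
  simp only [norm_pow, norm_norm, norm_div] at hz ⊢
  rcases (norm_nonneg z).eq_or_lt with h0 | h0
  · rw [← h0, div_zero]; positivity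
  · rw [div_le_iff₀ h0, mul_assoc, ← pow_succ]; exact hz

theorem tendsto_zero_of_isBigO {f : ℂ → ℂ} {n : ℕ} (h : f =O[𝓝 0] fun z => ‖z‖ ^ (n + 1)) :
    Tendsto f (𝓝 0) (𝓝 0) := by
  refine h.trans_tendsto ?_
  have : Continuous fun z : ℂ => ‖z‖ ^ (n + 1) := by fun_prop
  exact this.tendsto' 0 0 (by simp)

/-- Consistency of the second order backward difference formula, raised to the power `γ`. -/
theorem exists_bdf_consistency {γ : ℝ} (hγ : 0 < γ) :
    ∃ C : ℝ, 0 ≤ C ∧ ∀ z ∈ {z : ℂ | 0 ≤ z.re},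
      ‖bdf (Complex.exp (-z)) ^ (γ : ℂ) - z ^ (γ : ℂ)‖ ≤ C * ‖z‖ ^ (γ + 2) := by
  -- In `3/2 - 2 exp (-z) + exp (-2z) / 2` the quadratic Taylor polynomials add up to exactly `z`.
  -- Only cubic remainders are left, so the relative error `y` is quadratic.
  set y : ℂ → ℂ := fun z => (-2 * expRem z + expRem (2 * z) / 2) / z with hy
  have hbdf : ∀ z, bdf (Complex.exp (-z)) = z * (1 + y z) := by
    intro z
    by_cases hz : z = 0
    · simp [hz, bdf]
    · have e2 : Complex.exp (-(2 * z)) = Complex.exp (-z) ^ 2 := by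
        rw [← Complex.exp_nat_mul]; push_cast; ring_nf
      simp only [hy, bdf, expRem, e2]
      field_simp
      ring
  have hR2 : (fun z => expRem (2 * z)) =O[𝓝 0] fun z => ‖z‖ ^ 3 := by
    have ht : Tendsto (fun z : ℂ => 2 * z) (𝓝 0) (𝓝 0) :=
      (continuous_const.mul continuous_id).tendsto' 0 0 (by simp)
    refine (isBigO_expRem.comp_tendsto ht).trans ?_
    refine Asymptotics.IsBigO.of_bound 8 (.of_forall fun z => ?_)
    simp [mul_pow]; norm_num
  have hyO : y =O[𝓝 0] fun z => ‖z‖ ^ 2 := by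
    refine isBigO_div_self ((isBigO_expRem.const_mul_left (-2)).add ?_)
    simpa only [div_eq_inv_mul] using hR2.const_mul_left (2⁻¹ : ℂ)
  have hy0 : Tendsto (fun z => 1 + y z) (𝓝 0) (𝓝 1) := by
    simpa using (tendsto_zero_of_isBigO (n := 1) hyO).const_add 1
  have hE : (fun z => (1 + y z) ^ (γ : ℂ) - 1) =O[𝓝 0] fun z => ‖z‖ ^ 2 := by
    have hd : HasDerivAt (fun x : ℂ => x ^ (γ : ℂ)) (γ * 1 ^ ((γ : ℂ) - 1) * 1) 1 :=
      (hasDerivAt_id (1 : ℂ)).cpow_const (by simp)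
    have := hd.isBigO_sub.comp_tendsto hy0
    simp only [Function.comp_def, Complex.one_cpow, add_sub_cancel_left] at this
    exact this.trans hyO
  -- For `Re z ≥ 0` one has `‖1 - exp (-z)‖ ≤ 2`, hence `‖bdf‖ ≤ 2 + 4/2 = 4`.
  refine exists_consistency_const hγ (B := 4 ^ γ) (fun z hz => ?_) hE ?_
  · rw [Complex.norm_cpow_real]
    refine Real.rpow_le_rpow (norm_nonneg _) ?_ hγ.le
    have h1 : ‖Complex.exp (-z)‖ ≤ 1 := by
      rw [Complex.norm_exp, Real.exp_le_one_iff]; simpa using hz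
    have h2 : ‖1 - Complex.exp (-z)‖ ≤ 2 := by
      refine (norm_sub_le _ _).trans ?_; rw [norm_one]; linarith
    refine (norm_add_le _ _).trans ?_
    rw [norm_div, norm_pow]
    norm_num
    nlinarith [norm_nonneg (1 - Complex.exp (-z))]
  · have hpos : ∀ᶠ z in 𝓝 (0 : ℂ), 0 < (1 + y z).re := by
      have := (Complex.continuous_re.tendsto 1).comp hy0
      exact this.eventually (lt_mem_nhds (by simp))
    filter_upwards [hpos] with z hz hzS
    rw [hbdf, mul_cpow_of_re_nonneg hzS hz _ (by exact_mod_cast hγ.ne')]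
    ring

theorem isBigO_one_add_cpow (s : ℂ) :
    (fun y : ℂ => (1 + y) ^ s - 1 - s * y) =O[𝓝 0] fun y => ‖y‖ ^ 2 := by
  have h := (Complex.one_add_cpow_hasFPowerSeriesAt_zero (a := s)).isBigO_sub_partialSum_pow 2
  refine h.congr_left fun y => ?_
  simp [FormalMultilinearSeries.partialSum, Finset.sum_range_succ, binomialSeries,
    FormalMultilinearSeries.coeff_ofScalars]
  ring

/-- Consistency of the weighted and shifted Grünwald formula. -/
theorem exists_grunwald_consistency {α : ℝ} (hα : 0 < α) :
    ∃ C : ℝ, 0 ≤ C ∧ ∀ z ∈ {z : ℂ | z.re = 0},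
      ‖Complex.exp z * ((((α / 2 : ℝ) : ℂ) + ((1 - α / 2 : ℝ) : ℂ) * Complex.exp (-z)) *
        (1 - Complex.exp (-z)) ^ (α : ℂ)) - z ^ (α : ℂ)‖ ≤ C * ‖z‖ ^ (α + 2) := by
  set y : ℂ → ℂ := fun z => -(1 / 2) * z + -1 * (expRem z / z) with hy
  have hsub : ∀ z, 1 - Complex.exp (-z) = z * (1 + y z) := by
    intro z
    by_cases hz : z = 0
    · simp [hz]
    · simp only [hy, expRem]
      field_simp
      ring
  have hid : (fun z : ℂ => z) =O[𝓝 0] fun z => ‖z‖ ^ 1 := by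
    simpa using (Asymptotics.isBigO_refl (fun z : ℂ => z) (𝓝 0)).norm_right
  have hR1 : (fun z => expRem z / z) =O[𝓝 0] fun z => ‖z‖ ^ 2 := isBigO_div_self isBigO_expRem
  have hyO : y =O[𝓝 0] fun z => ‖z‖ ^ 1 :=
    (hid.const_mul_left _).add ((hR1.trans (isBigO_norm_pow one_le_two)).const_mul_left _)
  have hyt : Tendsto y (𝓝 0) (𝓝 0) := tendsto_zero_of_isBigO (n := 0) hyO
  -- the two factors
  set A : ℂ → ℂ := fun z => ((α / 2 : ℝ) : ℂ) * Complex.exp z + ((1 - α / 2 : ℝ) : ℂ) - 1 with hA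
  set A₂ : ℂ → ℂ := fun z => A z - (α / 2 : ℂ) * z with hA₂
  set D : ℂ → ℂ := fun z => (1 + y z) ^ (α : ℂ) - 1 with hD
  set D₂ : ℂ → ℂ := fun z => D z + (α / 2 : ℂ) * z with hD₂
  have hsq : ∀ c : ℂ, (fun z : ℂ => c * z ^ 2) =O[𝓝 0] fun z => ‖z‖ ^ 2 := fun c => by
    refine Asymptotics.IsBigO.of_bound ‖c‖ (.of_forall fun z => ?_)
    simp
  have hA₂O : A₂ =O[𝓝 0] fun z => ‖z‖ ^ 2 := by
    have ht : Tendsto (fun z : ℂ => -z) (𝓝 0) (𝓝 0) := continuous_neg.tendsto' 0 0 (by simp)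
    have h1 : (fun z => expRem (-z)) =O[𝓝 0] fun z => ‖z‖ ^ 2 := by
      have := isBigO_expRem.comp_tendsto ht
      simp only [Function.comp_def, norm_neg] at this
      exact this.trans (isBigO_norm_pow (by norm_num))
    refine ((h1.const_mul_left (α / 2 : ℂ)).add (hsq (α / 4))).congr_left fun z => ?_
    simp only [hA₂, hA, expRem, neg_neg]; push_cast; ring
  have hD₂O : D₂ =O[𝓝 0] fun z => ‖z‖ ^ 2 := by
    have h1 := (isBigO_one_add_cpow (α : ℂ)).comp_tendsto hyt
    simp only [Function.comp_def] at h1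
    have h2 : (fun z => ‖y z‖ ^ 2) =O[𝓝 0] fun z => ‖z‖ ^ 2 := by
      simpa using hyO.norm_left.pow 2
    refine ((h1.trans h2).add (hR1.const_mul_left (-(α : ℂ)))).congr_left fun z => ?_
    simp only [hD₂, hD, hy]; ring
  have hAO : A =O[𝓝 0] fun z => ‖z‖ ^ 1 := by
    refine ((hA₂O.trans (isBigO_norm_pow one_le_two)).add
      (hid.const_mul_left (α / 2 : ℂ))).congr_left fun z => ?_
    simp only [hA₂]; ring
  have hDO : D =O[𝓝 0] fun z => ‖z‖ ^ 1 := by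
    refine ((hD₂O.trans (isBigO_norm_pow one_le_two)).sub
      (hid.const_mul_left (α / 2 : ℂ))).congr_left fun z => ?_
    simp only [hD₂]; ring
  -- The linear terms `α z / 2` of `A` and `-α z / 2` of `D` cancel; this is what the weights `α/2`
  -- and `1 - α/2` are chosen for.
  have hE : (fun z => (1 + A z) * (1 + D z) - 1) =O[𝓝 0] fun z => ‖z‖ ^ 2 := by
    have h1 : (fun z => A z * D z) =O[𝓝 0] fun z => ‖z‖ ^ 2 := by
      refine (hAO.mul hDO).congr_right fun z => ?_
      ring
    refine ((hA₂O.add hD₂O).add h1).congr_left fun z => ?_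
    simp only [hA₂, hD₂]; ring
  refine exists_consistency_const hα (B := (|α / 2| + |1 - α / 2|) * 2 ^ α) (fun z hz => ?_) hE ?_
  · have hz' : z.re = 0 := hz
    have h1 : ‖Complex.exp (-z)‖ = 1 := by rw [Complex.norm_exp]; simp [hz']
    have h1' : ‖Complex.exp z‖ = 1 := by rw [Complex.norm_exp]; simp [hz']
    have h2 : ‖1 - Complex.exp (-z)‖ ≤ 2 := by
      refine (norm_sub_le _ _).trans ?_; rw [norm_one, h1]; norm_num
    rw [norm_mul, h1', one_mul, norm_mul, Complex.norm_cpow_real]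
    refine mul_le_mul ?_ (Real.rpow_le_rpow (norm_nonneg _) h2 hα.le) (by positivity)
      (by positivity)
    refine (norm_add_le _ _).trans ?_
    rw [norm_mul, h1, mul_one, Complex.norm_real, Complex.norm_real, Real.norm_eq_abs,
      Real.norm_eq_abs]
  · have hpos : ∀ᶠ z in 𝓝 (0 : ℂ), 0 < (1 + y z).re := by
      have h1 : Tendsto (fun z => 1 + y z) (𝓝 0) (𝓝 1) := by simpa using hyt.const_add 1
      have := (Complex.continuous_re.tendsto 1).comp h1
      exact this.eventually (lt_mem_nhds (by simp))
    filter_upwards [hpos] with z hz hzS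
    rw [hsub, mul_cpow_of_re_nonneg (le_of_eq (Eq.symm hzS)) hz _ (by exact_mod_cast hα.ne')]
    have hee : Complex.exp z * Complex.exp (-z) = 1 := by rw [← Complex.exp_add]; simp
    simp only [hA, hD]
    linear_combination (((1 - α / 2 : ℝ) : ℂ) * (z ^ (α : ℂ) * (1 + y z) ^ (α : ℂ))) * hee

/-- On the closed disc `bdf` stays in the closed right half-plane, where a power with positive
exponent is continuous even at zero, the value of `bdf` at `z = 1`. -/
theorem continuousOn_bdf_cpow {γ : ℝ} (hγ : 0 < γ) :
    ContinuousOn (fun z => bdf z ^ (γ : ℂ)) (Metric.closedBall 0 1) := by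
  intro z hz
  have hz1 : ‖z‖ ≤ 1 := by simpa using hz
  have hre : 0 ≤ (bdf z).re := by simpa using re_bdf_ge hz1 le_rfl
  have h1 := Complex.continuousAt_cpow_const_of_re_pos (Or.inl hre) (w := (γ : ℂ)) (by simpa using hγ)
  have h2 : Continuous bdf := by unfold bdf; fun_prop
  exact (h1.comp (f := bdf) h2.continuousAt).continuousWithinAt

theorem continuousOn_grunwald_symbol {α : ℝ} (hα : 0 < α) :
    ContinuousOn (fun z : ℂ => (((α / 2 : ℝ) : ℂ) + ((1 - α / 2 : ℝ) : ℂ) * z) *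
      (1 - z) ^ (α : ℂ)) (Metric.closedBall 0 1) := by
  intro z hz
  have hz1 : ‖z‖ ≤ 1 := by simpa using hz
  have hre : 0 ≤ (1 - z).re := by
    have := (Complex.re_le_norm z).trans hz1
    simpa using this
  have h1 := Complex.continuousAt_cpow_const_of_re_pos (Or.inl hre) (w := (α : ℂ)) (by simpa using hα)
  have h2 : Continuous fun z : ℂ => 1 - z := by fun_prop
  have h3 : Continuous fun z : ℂ => ((α / 2 : ℝ) : ℂ) + ((1 - α / 2 : ℝ) : ℂ) * z := by fun_prop
  exact (h3.continuousAt.mul (h1.comp (f := fun z : ℂ => 1 - z) h2.continuousAt)).continuousWithinAt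

/-! ### Consistency of the scheme -/

/-- Second order consistency of a quadrature, from that of its symbol. -/
theorem norm_quadrature_sub_le {Ψ : ℂ → ℂ} {S : Set ℂ} {β C : ℝ}
    (hC : ∀ z ∈ S, ‖Ψ z - z ^ (β : ℂ)‖ ≤ C * ‖z‖ ^ (β + 2)) (hC0 : 0 ≤ C) (hβ : 0 < β) {f : ℝ → ℂ}
    {μ : ℂ} {τ : ℝ} (hτ : 0 < τ) (hmem : ∀ w, symbol μ w * τ ∈ S)
    (hW : Integrable fun w => (1 + ‖symbol μ w‖) ^ (β + 2) * ‖f w‖)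
    (i1 : Integrable fun w => Ψ (symbol μ w * τ) * f w)
    (i2 : Integrable fun w => symbol μ w ^ (β : ℂ) * f w) (t : ℝ) :
    ‖((1 / τ ^ β : ℝ) : ℂ) * (∫ w, wave t w * (Ψ (symbol μ w * τ) * f w)) -
      ∫ w, wave t w * (symbol μ w ^ (β : ℂ) * f w)‖ ≤
      C * (∫ w, (1 + ‖symbol μ w‖) ^ (β + 2) * ‖f w‖) * τ ^ 2 := by
  rw [← integral_const_mul, ← integral_sub ((integrable_wave_mul i1 t).const_mul _)
    (integrable_wave_mul i2 t), mul_right_comm, ← integral_const_mul]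
  refine norm_integral_le_of_norm_le (hW.const_mul _) (.of_forall fun w => ?_)
  have hτβ : 0 < τ ^ β := by positivity
  have h1 : ((1 / τ ^ β : ℝ) : ℂ) * (wave t w * (Ψ (symbol μ w * τ) * f w)) -
      wave t w * (symbol μ w ^ (β : ℂ) * f w) =
      wave t w * (((1 / τ ^ β : ℝ) : ℂ) *
        (Ψ (symbol μ w * τ) - (symbol μ w * τ) ^ (β : ℂ)) * f w) := by
    rw [mul_comm (symbol μ w) (τ : ℂ), cpow_mul_of_pos hτ, ← Complex.ofReal_cpow hτ.le]
    have : ((τ ^ β : ℝ) : ℂ) ≠ 0 := by exact_mod_cast hτβ.ne'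
    push_cast at this ⊢
    field_simp
  rw [h1, norm_mul, norm_wave, one_mul, norm_mul, norm_mul, Complex.norm_real,
    Real.norm_of_nonneg (by positivity), ← mul_assoc]
  refine mul_le_mul_of_nonneg_right ?_ (norm_nonneg _)
  have h2 := hC _ (hmem w)
  rw [norm_mul, Complex.norm_real, Real.norm_of_nonneg hτ.le,
    Real.mul_rpow (norm_nonneg _) hτ.le, Real.rpow_add hτ, Real.rpow_two] at h2
  have h3 : ‖symbol μ w‖ ^ (β + 2) ≤ (1 + ‖symbol μ w‖) ^ (β + 2) :=
    rpow_le_one_add_rpow (norm_nonneg _) (by linarith) le_rfl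
  calc 1 / τ ^ β * ‖Ψ (symbol μ w * τ) - (symbol μ w * τ) ^ (β : ℂ)‖
      ≤ 1 / τ ^ β * (C * (‖symbol μ w‖ ^ (β + 2) * (τ ^ β * τ ^ 2))) := by gcongr
    _ = C * τ ^ 2 * ‖symbol μ w‖ ^ (β + 2) := by field_simp
    _ ≤ _ := by gcongr

/-- Consistency of the tempered quadrature with the substantial derivative. -/
theorem exists_substantial_consistency {γ : ℝ} (h0 : 0 < γ) (h1 : γ < 1) :
    ∃ C : ℝ, 0 ≤ C ∧
      (∀ lam τ : ℝ, 0 ≤ lam → 0 < τ →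
        |1 / τ ^ γ * temperConst γ lam τ - lam ^ γ| ≤ C * lam ^ (γ + 2) * τ ^ 2) ∧
      ∀ {μ : ℂ}, 0 ≤ μ.re → ∀ {T : ℝ} {g V : ℝ → ℂ}, Continuous V → Integrable V →
        (∀ t < 0, V t = 0) → (∀ t ∈ Set.Icc 0 T, V t = g t) →
        Integrable (fun w => (1 + ‖symbol μ w‖) ^ (γ + 2) * ‖𝓕 V w‖) →
        ∀ {τ : ℝ}, 0 < τ → ∀ {n : ℕ}, (n : ℝ) * τ ∈ Set.Ioc 0 T → ∀ {D : ℂ},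
        HasSubstantialDeriv γ μ T g (n * τ) D →
        ‖((1 / τ ^ γ : ℝ) : ℂ) * ∑ k ∈ Finset.range (n + 1),
            (lubich γ k : ℂ) * Complex.exp (-μ * τ) ^ k * g ((n - k : ℕ) * τ) - D‖ ≤
          C * (∫ w, (1 + ‖symbol μ w‖) ^ (γ + 2) * ‖𝓕 V w‖) * τ ^ 2 := by
  obtain ⟨C, hC0, hC⟩ := exists_bdf_consistency h0
  refine ⟨C, hC0, fun lam τ hlam hτ => ?_, ?_⟩
  -- The tempering constant is the quadrature symbol at the real point `lam τ`, so the same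
  -- consistency bound covers it.
  · have h := hC ((lam * τ : ℝ) : ℂ) (by simp; positivity)
    have hx : 0 ≤ lam * τ := by positivity
    have he : Real.exp (-lam * τ) ≤ 1 := Real.exp_le_one_iff.mpr (by linarith)
    have hb : bdf (Complex.exp (-((lam * τ : ℝ) : ℂ))) =
        (((1 - Real.exp (-lam * τ)) + (1 - Real.exp (-lam * τ)) ^ 2 / 2 : ℝ) : ℂ) := by
      simp only [bdf]; push_cast; ring_nf
    rw [hb, ← Complex.ofReal_cpow (by nlinarith), ← temperConst_eq, ← Complex.ofReal_cpow hx,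
      ← Complex.ofReal_sub, Complex.norm_real, Complex.norm_real, Real.norm_of_nonneg hx,
      Real.norm_eq_abs, Real.mul_rpow hlam hτ.le, Real.mul_rpow hlam hτ.le, Real.rpow_add hτ,
      Real.rpow_two] at h
    have hτγ : 0 < τ ^ γ := by positivity
    have e : 1 / τ ^ γ * temperConst γ lam τ - lam ^ γ =
        1 / τ ^ γ * (temperConst γ lam τ - lam ^ γ * τ ^ γ) := by field_simp
    rw [e, abs_mul, abs_of_pos (by positivity)]
    calc 1 / τ ^ γ * |temperConst γ lam τ - lam ^ γ * τ ^ γ|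
        ≤ 1 / τ ^ γ * (C * (lam ^ (γ + 2) * (τ ^ γ * τ ^ 2))) := by gcongr
      _ = _ := by field_simp
  · intro μ hμ T g V hVc hVi hneg hg hW τ hτ n ht D hD
    have hm := aestronglyMeasurable_fourier hVi
    have hF : Integrable (𝓕 V) := integrable_of_weight hm hW (by linarith)
    rw [hD.eq_integral h0 h1 hμ hVc hVi hneg hg (p := γ + 2) (by linarith) hW ht]
    -- These terms sample `V` at negative times, so the infinite quadrature stops at `k = n`.
    have hz : ∀ k : ℕ, n + 1 ≤ k → V (n * τ - k * τ) = 0 := by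
      intro k hk
      refine hneg _ ?_
      have : (n : ℝ) + 1 ≤ k := by exact_mod_cast hk
      nlinarith
    obtain ⟨i1, hsum⟩ := sum_weights_eq_integral (fun z hz => hasSum_lubich γ hz)
      (continuousOn_bdf_cpow h0) hVc hVi hF hμ hτ hz
    have hgV : ∑ k ∈ Finset.range (n + 1),
        (lubich γ k : ℂ) * Complex.exp (-μ * τ) ^ k * g ((n - k : ℕ) * τ) =
        ∑ k ∈ Finset.range (n + 1),
        (lubich γ k : ℂ) * Complex.exp (-μ * τ) ^ k * V (n * τ - k * τ) := by
      refine Finset.sum_congr rfl fun k hk => ?_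
      have hk' : k ≤ n := Nat.lt_succ_iff.mp (Finset.mem_range.mp hk)
      have e : ((n - k : ℕ) : ℝ) * τ = n * τ - k * τ := by
        rw [Nat.cast_sub hk']; ring
      rw [← hg _ ⟨by positivity, ?_⟩, e]
      rw [e]; have : 0 ≤ (k : ℝ) * τ := by positivity
      linarith [ht.2]
    rw [hgV, hsum]
    simp_rw [neg_mul] at i1 ⊢
    refine norm_quadrature_sub_le (Ψ := fun z => bdf (Complex.exp (-z)) ^ (γ : ℂ)) hC hC0 h0 hτ
      (fun w => ?_) hW i1 (integrable_symbol_cpow_mul hm hW h0.le (by linarith)) _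
    have : 0 ≤ μ.re * τ := by positivity
    simpa [symbol_re] using this

theorem wave_add (y x w : ℝ) : wave (y + x) w = Complex.exp (symbol 0 w * x) * wave y w := by
  rw [wave, wave, ← Complex.exp_add, symbol]; push_cast; ring_nf

/-- Consistency of the weighted and shifted Grünwald formula with the left derivative. -/
theorem exists_left_consistency {α : ℝ} (h1 : 1 < α) (h2 : α < 2) :
    ∃ C : ℝ, 0 ≤ C ∧ ∀ {u : ℝ → ℂ}, Continuous u → Integrable u →
        Integrable (fun w => (1 + ‖symbol 0 w‖) ^ (α + 2) * ‖𝓕 u w‖) →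
        ∀ {h : ℝ}, 0 < h → ∀ {x : ℝ} {m : ℕ}, (∀ k : ℕ, m ≤ k → u (x + h - k * h) = 0) →
        ∀ {D : ℂ}, HasLeftDeriv α u x D →
        ‖((1 / h ^ α : ℝ) : ℂ) * ∑ k ∈ Finset.range m,
            (spaceWeight α k : ℂ) * u (x + h - k * h) - D‖ ≤
          C * (∫ w, (1 + ‖symbol 0 w‖) ^ (α + 2) * ‖𝓕 u w‖) * h ^ 2 := by
  have h0 : 0 < α := by linarith
  obtain ⟨C, hC0, hC⟩ := exists_grunwald_consistency h0
  refine ⟨C, hC0, ?_⟩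
  intro u huc hui hW h hh x m hz D hD
  have hm := aestronglyMeasurable_fourier hui
  have hF : Integrable (𝓕 u) := integrable_of_weight hm hW (by linarith)
  rw [hD.eq_integral h1 h2 huc hui (p := α + 2) (by linarith) hW]
  obtain ⟨i1, hsum⟩ := sum_weights_eq_integral (fun z hz => hasSum_spaceWeight α hz)
    (continuousOn_grunwald_symbol h0) huc hui hF (μ := 0) le_rfl hh hz
  simp only [neg_zero, zero_mul, Complex.exp_zero, one_pow, mul_one] at hsum
  rw [hsum]
  -- Evaluating at `x + h` multiplies the symbol by `exp z`, the shift factor in the Grünwald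
  -- consistency bound.
  simp_rw [wave_add x h, neg_mul] at i1 ⊢
  have i2 : Integrable fun w => (Complex.exp (symbol 0 w * h) *
      ((((α / 2 : ℝ) : ℂ) + ((1 - α / 2 : ℝ) : ℂ) * Complex.exp (-(symbol 0 w * h))) *
        (1 - Complex.exp (-(symbol 0 w * h))) ^ (α : ℂ))) * 𝓕 u w := by
    have := i1.bdd_mul (c := 1) (f := fun w => Complex.exp (symbol 0 w * h))
      (Continuous.aestronglyMeasurable (by fun_prop)) (.of_forall fun w => by
        rw [Complex.norm_exp]; simp [symbol_re])
    simpa only [mul_assoc] using this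
  have key := norm_quadrature_sub_le hC hC0 h0 hh (fun w => by simp [symbol_re]) hW i2
    (integrable_symbol_cpow_mul hm hW h0.le (by linarith)) x
  refine le_trans (le_of_eq ?_) key
  congr 3
  refine integral_congr_ae (.of_forall fun w => ?_)
  simp only; ring

theorem norm_symbol_zero (w : ℝ) : ‖symbol 0 w‖ = |2 * π * w| := by
  simp [symbol, abs_of_pos Real.pi_pos, abs_mul]

theorem fourier_comp_neg (u : ℝ → ℂ) (w : ℝ) : 𝓕 (fun y => u (-y)) w = 𝓕 u (-w) := by
  rw [Real.fourier_eq', Real.fourier_eq', ← integral_neg_eq_self]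
  simp

theorem norm_symbol_zero_neg (w : ℝ) : ‖symbol 0 (-w)‖ = ‖symbol 0 w‖ := by
  rw [norm_symbol_zero, norm_symbol_zero, mul_neg, abs_neg]

/-- Consistency of the discrete Riesz operator. -/
theorem exists_riesz_consistency {α : ℝ} (h1 : 1 < α) (h2 : α < 2) :
    ∃ C : ℝ, 0 ≤ C ∧ ∀ {u : ℝ → ℂ} {b : ℝ}, 0 < b → Continuous u →
        (∀ x, x ∉ Set.Ioo 0 b → u x = 0) →
        Integrable (fun w => (1 + ‖symbol 0 w‖) ^ (α + 2) * ‖𝓕 u w‖) →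
        ∀ {M i : ℕ}, i ∈ Finset.Ioo 0 M → ∀ {D : ℂ}, HasRieszDeriv α u (i * (b / M)) D →
        ‖((-rieszConst α / (b / M) ^ α : ℝ) : ℂ) * ∑ j ∈ Finset.range (M + 1),
            (spaceEntry α i j : ℂ) * u (j * (b / M)) - D‖ ≤
          |rieszConst α| * (C * (∫ w, (1 + ‖symbol 0 w‖) ^ (α + 2) * ‖𝓕 u w‖)) * (b / M) ^ 2 := by
  obtain ⟨C, hC0, hC⟩ := exists_left_consistency h1 h2
  refine ⟨2 * C, by positivity, ?_⟩
  intro u b hb huc hu0 hW M i hi D hD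
  have hiM := Finset.mem_Ioo.mp hi
  have hM : (0 : ℝ) < M := by exact_mod_cast hiM.1.trans hiM.2
  set h := b / M with hh
  have hhpos : 0 < h := by positivity
  have hMh : M * h = b := by rw [hh]; field_simp
  obtain ⟨Dl, Dr, hl, hr, rfl⟩ := hD
  have hui : Integrable u := by
    refine huc.integrable_of_hasCompactSupport ?_
    refine HasCompactSupport.of_support_subset_isCompact (isCompact_Icc (a := 0) (b := b)) ?_
    intro x hx
    by_contra hn
    exact hx (hu0 x fun h => hn (Set.Ioo_subset_Icc_self h))
  set I := ∫ w, (1 + ‖symbol 0 w‖) ^ (α + 2) * ‖𝓕 u w‖ with hI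
  have hWneg : Integrable (fun w => (1 + ‖symbol 0 w‖) ^ (α + 2) * ‖𝓕 (fun y => u (-y)) w‖) := by
    simp_rw [fourier_comp_neg]
    have := hW.comp_neg
    simpa only [norm_symbol_zero_neg] using this
  have hIneg : ∫ w, (1 + ‖symbol 0 w‖) ^ (α + 2) * ‖𝓕 (fun y => u (-y)) w‖ = I := by
    simp_rw [fourier_comp_neg]
    rw [hI, ← integral_neg_eq_self]
    simp only [norm_symbol_zero_neg, neg_neg]
  -- From index `i + 2` on the left, and from `M - i + 2` on for the reflected function, the sampled
  -- points lie outside `(0, b)`, so the finite sums are the full quadratures.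
  have kl := hC huc hui hW hhpos (x := i * h) (m := i + 2) (fun k hk => hu0 _ fun hx => by
    have : (i : ℝ) + 2 ≤ k := by exact_mod_cast hk
    nlinarith [hx.1]) hl
  have kr := hC (u := fun y => u (-y)) (huc.comp continuous_neg) hui.comp_neg hWneg hhpos
    (x := -(i * h)) (m := M - i + 2) (fun k hk => hu0 _ fun hx => by
      have : (M : ℝ) - i + 2 ≤ k := by
        have : M + 2 ≤ k + i := by omega
        have : (M : ℝ) + 2 ≤ k + i := by exact_mod_cast this
        linarith
      nlinarith [hx.2]) hr.comp_neg
  rw [hIneg] at kr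
  have el := sum_leftEntry_mul (α := α) hiM.2 (fun j => u (j * h))
  have er := sum_leftEntry_swap_mul (α := α) hiM.2.le hiM.1 (fun j => u (j * h))
  have el' : ∑ k ∈ Finset.range (i + 2), (spaceWeight α k : ℂ) * u (((i + 1 - k : ℕ) : ℝ) * h) =
      ∑ k ∈ Finset.range (i + 2), (spaceWeight α k : ℂ) * u (i * h + h - k * h) := by
    refine Finset.sum_congr rfl fun k hk => ?_
    have := Finset.mem_range.mp hk
    rw [Nat.cast_sub (by omega)]; push_cast; ring_nf
  have er' : ∑ k ∈ Finset.range (M - i + 2),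
      (spaceWeight α k : ℂ) * u (((i - 1 + k : ℕ) : ℝ) * h) =
      ∑ k ∈ Finset.range (M - i + 2), (spaceWeight α k : ℂ) * u (-(-(i * h) + h - k * h)) := by
    refine Finset.sum_congr rfl fun k hk => ?_
    rw [Nat.cast_add, Nat.cast_sub hiM.1]; push_cast; ring_nf
  have hsplit : ∑ j ∈ Finset.range (M + 1), (spaceEntry α i j : ℂ) * u (j * h) =
      ∑ j ∈ Finset.range (M + 1), (leftEntry α i j : ℂ) * u (j * h) +
      ∑ j ∈ Finset.range (M + 1), (leftEntry α j i : ℂ) * u (j * h) := by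
    rw [← Finset.sum_add_distrib]
    refine Finset.sum_congr rfl fun j _ => ?_
    rw [spaceEntry_eq]; push_cast; ring
  rw [hsplit, el, er, el', er']
  set Sl := ∑ k ∈ Finset.range (i + 2), (spaceWeight α k : ℂ) * u (i * h + h - k * h)
  set Sr := ∑ k ∈ Finset.range (M - i + 2), (spaceWeight α k : ℂ) * u (-(-(i * h) + h - k * h))
  have e : ((-rieszConst α / h ^ α : ℝ) : ℂ) * (Sl + Sr) - -(rieszConst α : ℂ) * (Dl + Dr) =
      -(rieszConst α : ℂ) * ((((1 / h ^ α : ℝ) : ℂ) * Sl - Dl) +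
        (((1 / h ^ α : ℝ) : ℂ) * Sr - Dr)) := by
    push_cast; ring
  rw [e, norm_mul, norm_neg, Complex.norm_real, Real.norm_eq_abs, mul_assoc |rieszConst α|]
  refine mul_le_mul_of_nonneg_left ?_ (abs_nonneg _)
  refine (norm_add_le _ _).trans ((add_le_add kl kr).trans_eq ?_)
  ring

/-- The local truncation error of a regular solution is of second order in time and space. -/
theorem exists_truncationBound (P : Problem) {G : ℝ → ℝ → ℂ} (hG : P.IsSolution G)
    (ht : P.TimeRegular G) (hs : P.SpaceRegular G) :
    ∃ C : ℝ, 0 < C ∧ ∀ M N : ℕ, ∀ τ : ℝ, 0 < τ → N * τ ≤ P.T → P.TruncationBound G C M N τ := by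
  obtain ⟨Bt, hBt⟩ := ht
  obtain ⟨Bx, hBx⟩ := hs
  obtain ⟨Ct, hCt0, hCσ, hCt⟩ := exists_substantial_consistency P.γ_pos P.γ_lt_one
  obtain ⟨Cx, hCx0, hCx⟩ := exists_riesz_consistency P.one_lt_α P.α_lt_two
  have hK := P.K_pos
  have hlam := P.lam_nonneg
  set Kt := Ct * |Bt| + Ct * P.lam ^ (P.γ + 2) * |Bx| with hKt
  set Kx := P.K * (|rieszConst P.α| * (Cx * |Bx|)) with hKx
  have hKt0 : 0 ≤ Kt := by positivity
  have hKx0 : 0 ≤ Kx := by positivity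
  -- The summand `1` only ensures strict positivity.
  refine ⟨Kt + Kx + 1, by positivity, ?_⟩
  intro M N τ hτ hT n hn i hi
  have htn := P.mem_Ioc_of_mem_Icc hτ hT hn
  set x := P.node M i with hx
  have hxm : x ∈ Set.Ioo 0 P.b := P.node_mem hi
  obtain ⟨Dt, Dx, hDt, hDx, heq⟩ := hG.equation x hxm _ htn
  obtain ⟨V, hVc, hVi, hneg, hVg, hVW, hVB⟩ := hBt x hxm
  obtain ⟨huc, huW, huB⟩ := hBx _ htn
  set u : ℝ → ℂ := fun y => G y (n * τ) with hu
  have hu0 : ∀ y, y ∉ Set.Ioo 0 P.b → u y = 0 := fun y hy => hG.boundary y hy _ htn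
  simp_rw [← norm_symbol_zero] at huW huB
  have hre : 0 ≤ (P.rate x).re := by
    have := mul_nonneg P.ρ_pos.le (P.U_nonneg x hxm)
    simp [Problem.rate]; linarith
  have k1 := hCt hre hVc hVi hneg hVg hVW hτ htn hDt
  have k2 := hCσ P.lam τ hlam hτ
  have k3 := hCx P.b_pos huc hu0 huW hi hDx
  -- The spatial regularity also gives a uniform bound on the solution, needed because the
  -- discrepancy between `temperConst / τ ^ γ` and `lam ^ γ` multiplies it.
  have hGb : ‖G x (n * τ)‖ ≤ |Bx| := by
    have hui : Integrable u := by
      refine huc.integrable_of_hasCompactSupport ?_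
      refine HasCompactSupport.of_support_subset_isCompact (isCompact_Icc (a := 0) (b := P.b)) ?_
      intro y hy
      by_contra hn
      exact hy (hu0 y fun h => hn (Set.Ioo_subset_Icc_self h))
    have hα := P.one_lt_α
    have hF : Integrable (𝓕 u) :=
      integrable_of_weight (aestronglyMeasurable_fourier hui) huW (by linarith)
    refine (norm_le_integral_norm_fourier huc hui hF x).trans ?_
    refine le_trans ?_ (huB.trans (le_abs_self Bx))
    refine integral_mono hF.norm huW fun w => ?_
    have : 1 ≤ (1 + ‖symbol 0 w‖) ^ (P.α + 2) :=
      Real.one_le_rpow (by linarith [norm_nonneg (symbol 0 w)]) (by linarith)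
    exact le_mul_of_one_le_left (norm_nonneg _) this
  -- the three contributions
  set St := ∑ k ∈ Finset.range (n + 1), (lubich P.γ k : ℂ) * Complex.exp (-P.rate x * τ) ^ k *
    P.shifted G x ((n - k : ℕ) * τ) with hSt
  set Sx := ∑ j ∈ Finset.range (M + 1), (spaceEntry P.α i j : ℂ) * u (j * (P.b / M)) with hSx
  -- Eliminating the source through the differential equation leaves three independent consistency
  -- errors: the time quadrature, the tempering constant and the Riesz operator.
  have hr : P.truncationError G M τ i n = (((1 / τ ^ P.γ : ℝ) : ℂ) * St - Dt) -
      ((1 / τ ^ P.γ * temperConst P.γ P.lam τ - P.lam ^ P.γ : ℝ) : ℂ) * G x (n * τ) -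
      (P.K : ℂ) * (((-rieszConst P.α / (P.b / M) ^ P.α : ℝ) : ℂ) * Sx - Dx) := by
    have e1 : St = ∑ k ∈ Finset.range (n + 1), Complex.exp (-P.rate x * (k * τ : ℝ)) *
          (lubich P.γ k : ℂ) * G x ((n - k : ℕ) * τ) -
        ∑ k ∈ Finset.range (n + 1), Complex.exp (-P.rate x * (k * τ : ℝ)) *
          (lubich P.γ k : ℂ) * (Complex.exp (-P.rate x * ((n - k : ℕ) * τ : ℝ)) * G x 0) := by
      rw [hSt, ← Finset.sum_sub_distrib]
      refine Finset.sum_congr rfl fun k _ => ?_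
      rw [exp_neg_rate_mul P x τ k, Problem.shifted]
      ring
    rw [e1]
    unfold Problem.truncationError
    have e2 : P.f x (n * τ) = Dt - ((P.lam ^ P.γ : ℝ) : ℂ) * G x (n * τ) - (P.K : ℂ) * Dx := by
      rw [heq]; ring
    rw [← hx, e2]
    simp only [hSx, hu, Problem.node, Problem.step]
    push_cast
    ring
  have k1' : ‖((1 / τ ^ P.γ : ℝ) : ℂ) * St - Dt‖ ≤ Ct * |Bt| * τ ^ 2 := by
    refine k1.trans ?_
    gcongr
    exact hVB.trans (le_abs_self _)
  have k2' : ‖((1 / τ ^ P.γ * temperConst P.γ P.lam τ - P.lam ^ P.γ : ℝ) : ℂ) * G x (n * τ)‖ ≤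
      Ct * P.lam ^ (P.γ + 2) * τ ^ 2 * |Bx| := by
    rw [norm_mul, Complex.norm_real, Real.norm_eq_abs]
    gcongr
  have k3' : ‖(P.K : ℂ) * (((-rieszConst P.α / (P.b / M) ^ P.α : ℝ) : ℂ) * Sx - Dx)‖ ≤
      Kx * P.step M ^ 2 := by
    rw [norm_mul, Complex.norm_real, Real.norm_of_nonneg hK.le, hKx, mul_assoc P.K]
    refine mul_le_mul_of_nonneg_left (k3.trans ?_) hK.le
    rw [Problem.step]
    gcongr
    exact huB.trans (le_abs_self _)
  rw [hr]
  refine (norm_sub_le _ _).trans ((add_le_add (norm_sub_le _ _) le_rfl).trans ?_)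
  have hτ2 := sq_nonneg τ
  have hh2 := sq_nonneg (P.step M)
  have e : Kt * τ ^ 2 = Ct * |Bt| * τ ^ 2 + Ct * P.lam ^ (P.γ + 2) * τ ^ 2 * |Bx| := by
    rw [hKt]; ring
  nlinarith [mul_nonneg hKt0 hh2, mul_nonneg hKx0 hτ2]

end FeynmanKac

theorem theorem3p10 (P : FeynmanKac.Problem) (G : ℝ → ℝ → ℂ) (hG : P.IsSolution G) :
    -- on every mesh, every constant that bounds the local truncation error gives the estimate
    (∀ C : ℝ, 0 < C → ∀ M N : ℕ, 1 ≤ M → ∀ τ : ℝ, 0 < τ → N * τ ≤ P.T →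
      P.TruncationBound G C M N τ →
      ∀ g : ℕ → ℕ → ℂ, P.IsSchemeSolution M N τ g → P.ErrorBound G C M N τ g) ∧
    -- for a regular solution such a constant exists, independent of the mesh: the scheme
    -- converges with second order in time and space
    (P.TimeRegular G → P.SpaceRegular G →
      ∃ C : ℝ, 0 < C ∧ ∀ M N : ℕ, 1 ≤ M → ∀ τ : ℝ, 0 < τ → N * τ ≤ P.T →
        P.TruncationBound G C M N τ ∧
        ∀ g : ℕ → ℕ → ℂ, P.IsSchemeSolution M N τ g → P.ErrorBound G C M N τ g) := by
  have stab := fun (C : ℝ) (hC : 0 < C) (M N : ℕ) (hM : 1 ≤ M) (τ : ℝ) (hτ : 0 < τ)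
    (hT : N * τ ≤ P.T) (hr : P.TruncationBound G C M N τ) (g : ℕ → ℕ → ℂ)
    (hg : P.IsSchemeSolution M N τ g) =>
      FeynmanKac.errorBound_of_truncationBound P hG hC hM hτ hT hr hg
  refine ⟨stab, fun ht hs => ?_⟩
  obtain ⟨C, hC, hr⟩ := FeynmanKac.exists_truncationBound P hG ht hs
  exact ⟨C, hC, fun M N hM τ hτ hT =>
    ⟨hr M N τ hτ hT, stab C hC M N hM τ hτ hT (hr M N τ hτ hT)⟩⟩
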